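/- Let $C$ be a binary $t\times n$ matrix with columns $c_1,\dots,c_n$. For $D\subseteq\{1,\dots,n\}$ let $\bigvee_{i\in D}c_i$ be the coordinatewise Boolean sum (OR) of the columns indexed by $D$ (the all-zero vector if $D=\emptyset$), and say that a vector $x$ covers a vector $y$ if $x\vee y=x$. The matrix $C$ is called a $d$-union-free code with fast decoding ($d$-UFFD code) of length $t$ and cardinality $n$ if 1. for any two different sets $D_1,D_2\subseteq\{1,\dots,n\}$ with $|D_1|,|D_2|\le d$ we have $\bigvee_{i\in D_1}c_i\ne\bigvee_{i\in D_2}c_i$; 2. for every $D\subseteq\{1,\dots,n\}$ with $|D|\le d$ the vector $\bigvee_{i\in D}c_i$ covers at most $n^{1/d}$ columns of $C$. Let $n_{UFFD}(t,d)$ be the maximum cardinality of a $d$-UFFD code of length $t$, and let $$R_{UFFD}(d)=\limsup_{t\to\infty}\frac{\log_2 n_{UFFD}(t,d)}{t}.$$ Let $h(x)=-x\log_2x-(1-x)\log_2(1-x)$. **Theorem.** $$R_{UFFD}(2)\ge 0.3017.$$ More precisely, $$R_{UFFD}(2)\ \ge\ \max_{p\in(0,1)}\min\bigl(R_0(p),R_1(p)\bigr),$$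 where $$R_0(p)=\min_{\alpha\in A_p}\frac{4h(p)-2\alpha h(p/\alpha)-2p\,h\bigl(\frac{\alpha-p}{p}\bigr)-h(\alpha)}{3},$$ $$R_1(p)=\min_{\alpha\in A_p}\frac{2h(p)-2p\,h\bigl(\frac{\alpha-p}{p}\bigr)-(1-p)h\bigl(\frac{\alpha-p}{1-p}\bigr)}{2},$$ and $A_p=(p,\min(2p,1))$; in particular all these minima and the maximum are attained. -/

import Mathlib

open Set Filter

namespace UFFD

/-- The Boolean sum of the columns of `C` with index in `D` (all-zero if `D` is empty).
The lattice operation on `Fin t → Bool` is the coordinatewise `||`. -/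
noncomputable def outcome {t n : ℕ} (C : Matrix (Fin t) (Fin n) Bool) (D : Finset (Fin n)) : Fin t → Bool :=
  D.sup (fun j => C.col j)

/-- `x` covers `y` if the Boolean sum of `x` and `y` equals `x`. -/
def Covers {t : ℕ} (x y : Fin t → Bool) : Prop := x ⊔ y = x

/-- Boolean sums of two different sets of at most `d` columns are distinct. -/
def IsUnionFree (d : ℕ) {t n : ℕ} (C : Matrix (Fin t) (Fin n) Bool) : Prop :=
  ∀ D₁ D₂ : Finset (Fin n), D₁.card ≤ d → D₂.card ≤ d → D₁ ≠ D₂ → outcome C D₁ ≠ outcome C D₂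

/-- A `d`-union-free code with fast decoding: a `d`-union-free code such that every Boolean sum
of at most `d` columns covers at most `n^(1/d)` of the `n` columns. -/
def IsUFFD (d : ℕ) {t n : ℕ} (C : Matrix (Fin t) (Fin n) Bool) : Prop :=
  IsUnionFree d C ∧
    ∀ D : Finset (Fin n), D.card ≤ d →
      ({j : Fin n | Covers (outcome C D) (C.col j)}.ncard : ℝ) ≤ (n : ℝ) ^ (1 / (d : ℝ))

/-- The possible cardinalities (numbers of columns) of `d`-UFFD codes of length `t`. -/
def cardinalities (t d : ℕ) : Set ℕ :=
  {n | ∃ C : Matrix (Fin t) (Fin n) Bool, IsUFFD d C}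

/-- The maximum cardinality of a `d`-UFFD code of length `t`. -/
noncomputable def maxCard (t d : ℕ) : ℕ := sSup (cardinalities t d)

/-- The maximum asymptotic rate of `d`-UFFD codes. -/
noncomputable def rate (d : ℕ) : ℝ :=
  limsup (fun t : ℕ => Real.logb 2 (maxCard t d : ℝ) / (t : ℝ)) atTop

/-- The maximum in `maxCard` is over a set of numbers at most `2 ^ t`. -/
theorem le_two_pow_of_mem {t d n : ℕ} (hd : 1 ≤ d) (hn : n ∈ cardinalities t d) :
    n ≤ 2 ^ t := by
  obtain ⟨C, hC, -⟩ := hn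
  have hinj : Function.Injective (fun j : Fin n => C.col j) := by
    intro i j hij
    by_contra hne
    refine hC {i} {j} (by simpa using hd) (by simpa using hd) (by simpa using hne) ?_
    simpa [outcome] using hij
  simpa using Fintype.card_le_of_injective _ hinj

/-- The maximum in `maxCard` is attained. -/
theorem isGreatest_maxCard {t d : ℕ} (hd : 1 ≤ d) :
    IsGreatest (cardinalities t d) (maxCard t d) := by
  have hb : BddAbove (cardinalities t d) := ⟨2 ^ t, fun n hn => le_two_pow_of_mem hd hn⟩
  refine ⟨Nat.sSup_mem ⟨0, fun _ j => j.elim0, ?_, ?_⟩ hb, fun n hn => le_csSup hb hn⟩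
  · intro D₁ D₂ _ _ h
    exact absurd (Subsingleton.elim D₁ D₂) h
  · intro D _
    rw [Set.eq_empty_of_isEmpty {j : Fin 0 | _}]
    simp only [Set.ncard_empty, Nat.cast_zero]
    positivity

/-- The sequence in `rate` is bounded, so that its real `limsup` is the usual one. -/
theorem rate_seq_mem_Icc {d : ℕ} (hd : 1 ≤ d) (t : ℕ) :
    Real.logb 2 (maxCard t d : ℝ) / (t : ℝ) ∈ Icc (0 : ℝ) 1 := by
  have hle : (maxCard t d : ℝ) ≤ 2 ^ t := by
    exact_mod_cast le_two_pow_of_mem hd (isGreatest_maxCard (t := t) hd).1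
  rcases Nat.eq_zero_or_pos (maxCard t d) with h0 | hpos
  · simp [h0]
  · have h1 : (1 : ℝ) ≤ maxCard t d := by exact_mod_cast hpos
    refine ⟨div_nonneg (Real.logb_nonneg (by norm_num) h1) (Nat.cast_nonneg t), ?_⟩
    refine div_le_one_of_le₀ ?_ (Nat.cast_nonneg t)
    rw [Real.logb_le_iff_le_rpow (by norm_num) (by linarith)]
    simpa using hle

/-- The binary entropy function, to base 2. -/
noncomputable def h (x : ℝ) : ℝ := -x * Real.logb 2 x - (1 - x) * Real.logb 2 (1 - x)

/-- The range of `α`. -/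
def A (p : ℝ) : Set ℝ := Ioo p (min (2 * p) 1)

/-- The expression minimized in `R₀`. -/
noncomputable def F₀ (p α : ℝ) : ℝ :=
  (4 * h p - 2 * α * h (p / α) - 2 * p * h ((α - p) / p) - h α) / 3

/-- The expression minimized in `R₁`. -/
noncomputable def F₁ (p α : ℝ) : ℝ :=
  (2 * h p - 2 * p * h ((α - p) / p) - (1 - p) * h ((α - p) / (1 - p))) / 2

/-- The minimum of `F₀ p α` over `α ∈ A p`. -/
noncomputable def R₀ (p : ℝ) : ℝ := sInf (F₀ p '' A p)

/-- The minimum of `F₁ p α` over `α ∈ A p`. -/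
noncomputable def R₁ (p : ℝ) : ℝ := sInf (F₁ p '' A p)

end UFFD

/-! The bound comes from random coding with alteration. Fix `p`, let `w = ⌊p t⌋`, and put each
binary vector of weight `w` into `S` independently with probability `ρ = N / t.choose w`, where `N =
2 ^ (r t)`. Constant weight makes the columns an antichain, so union-freeness can fail only through
a triple with `x ⊔ y = x ⊔ z` or a quadruple with `x ⊔ y = z ⊔ u`, all vectors distinct; one vector
is deleted from each. A sum of two columns has weight at most `2 w`, so it covers at most `4 ^ w`
candidates, and an exponential moment with a union bound keeps the number of covered members of `S`
below about `√N / 2` (`exists_large_subset`, `exists_mem_cardinalities`).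

Bad triples and quadruples are counted by generating functions with a free parameter `μ` or `l`. The
resulting exponents `dual₁`, `dual₀` are Lagrangian duals of the minimizations over `α`, the
relative weight of `x ⊔ y`. Weak duality is Gibbs' inequality. Equality holds at a stationary `α`,
which also shows that the minima are attained (`isLeast_R₁`, `isLeast_R₀`). Hence any `r < min (R₀
p) (R₁ p)` leaves few bad configurations. The covering requirement `r / 2 < h p - 2 p` then follows
for `p ∈ [1/8, 2/5]` (`R₁_lt_two_mul`).

The maximum over `p` exists because `R₀` and `R₁` are upper semicontinuous, while outside `[1/8,
2/5]` one has `R₁ ≤ 0.3`, below the value at `p = 5/16`. That value is bounded below by evaluating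
the duals at rational parameters. -/

namespace UFFD

open Real Topology

/-! ### Lagrangian duality for the minimizations over `α` -/

theorem h_eq_binEntropy_div (x : ℝ) : h x = binEntropy x / log 2 := by
  simp only [h, logb, binEntropy, log_inv]
  ring

/-- This is `log z ≤ z - 1` at `z = T y / x`. The error terms `T y - x` cancel when summed over the
two points of a distribution. -/
theorem mul_log_le_mul_log {x T y : ℝ} (hT : 0 < T) (hx : 0 ≤ x) (hy : 0 < y) :
    x * log y ≤ x * log (x / T) + (T * y - x) := by
  rcases hx.eq_or_lt with rfl | hx
  · simp; positivity
  · have h1 : log (T * y / x) ≤ T * y / x - 1 := log_le_sub_one_of_pos (by positivity)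
    rw [log_div (by positivity) hx.ne', log_mul hT.ne' hy.ne'] at h1
    rw [log_div hx.ne' hT.ne']
    have h2 := mul_le_mul_of_nonneg_left h1 hx.le
    have h3 : x * (T * y / x - 1) = T * y - x := by field_simp
    linarith

theorem mul_binEntropy_div {x T : ℝ} (hT : 0 < T) :
    T * binEntropy (x / T) = -(x * log (x / T) + (T - x) * log ((T - x) / T)) := by
  have : 1 - x / T = (T - x) / T := by field_simp
  simp only [binEntropy, log_inv, this]
  field_simp
  ring

/-- Gibbs' inequality for two-point distributions. -/
theorem mul_binEntropy_div_le {x T y : ℝ} (hT : 0 < T) (hx : 0 ≤ x) (hxT : x ≤ T)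
    (hy : 0 < y) (hy1 : y < 1) :
    T * binEntropy (x / T) ≤ -(x * log y + (T - x) * log (1 - y)) := by
  have h1 := mul_log_le_mul_log hT hx hy
  have h2 := mul_log_le_mul_log hT (sub_nonneg.2 hxT) (sub_pos.2 hy1)
  rw [mul_binEntropy_div hT]
  linarith

theorem mul_binEntropy_div_eq {x T : ℝ} (hx : 0 < x) (hxT : x < T) :
    T * binEntropy (x / T) = T * log T - x * log x - (T - x) * log (T - x) := by
  have hT := hx.trans hxT
  rw [mul_binEntropy_div hT, log_div hx.ne' hT.ne', log_div (sub_pos.2 hxT).ne' hT.ne']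
  ring

/-- The Lagrangian dual of the minimization in `R₁`, scaled by `2 log 2`. -/
noncomputable def dual₁ (p μ : ℝ) : ℝ :=
  2 * binEntropy p + 2 * p * (log μ - log (1 + μ)) - (1 - p) * log (1 + μ ^ 2)

/-- The Lagrangian dual of the minimization in `R₀`, scaled by `3 log 2`. -/
noncomputable def dual₀ (p l : ℝ) : ℝ :=
  4 * binEntropy p + 4 * p * log l - log (1 + (2 * l + l ^ 2) ^ 2)

theorem two_log_two_mul_F₁ (p α : ℝ) : 2 * log 2 * F₁ p α =
    2 * binEntropy p - 2 * (p * binEntropy ((α - p) / p))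
      - (1 - p) * binEntropy ((α - p) / (1 - p)) := by
  have : log 2 ≠ 0 := (log_pos one_lt_two).ne'
  simp only [F₁, h_eq_binEntropy_div]
  field_simp

theorem three_log_two_mul_F₀ (p α : ℝ) : 3 * log 2 * F₀ p α =
    4 * binEntropy p - 2 * (α * binEntropy (p / α)) - 2 * (p * binEntropy ((α - p) / p))
      - binEntropy α := by
  have : log 2 ≠ 0 := (log_pos one_lt_two).ne'
  simp only [F₀, h_eq_binEntropy_div]
  field_simp

theorem mem_A {p α : ℝ} : α ∈ A p ↔ p < α ∧ α < 2 * p ∧ α < 1 := by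
  simp [A]

/-- Gibbs' inequality is applied with the product distribution behind the generating function: given
`x`, a bit of `y` is `0` with probability `1 / (1 + μ)` where `x` is `1`, and `y = z = 1` with
probability `μ ^ 2 / (1 + μ ^ 2)` where `x` is `0`. For this choice `α` drops out of the bound. -/
theorem dual₁_le {p α μ : ℝ} (hp : p ∈ Ioo (0 : ℝ) 1) (hα : α ∈ A p) (hμ : 0 < μ) :
    dual₁ p μ ≤ 2 * log 2 * F₁ p α := by
  obtain ⟨h1, h2, h3⟩ := mem_A.1 hα
  obtain ⟨hp0, hp1⟩ := hp
  have g1 := mul_binEntropy_div_le (x := α - p) (y := 1 / (1 + μ)) hp0 (by linarith) (by linarith)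
    (by positivity) (by rw [div_lt_one (by positivity)]; linarith)
  have g2 := mul_binEntropy_div_le (x := α - p) (T := 1 - p) (y := μ ^ 2 / (1 + μ ^ 2))
    (by linarith) (by linarith) (by linarith) (by positivity)
    (by rw [div_lt_one (by positivity)]; linarith)
  have e1 : 1 - 1 / (1 + μ) = μ / (1 + μ) := by field_simp; ring
  have e2 : 1 - μ ^ 2 / (1 + μ ^ 2) = 1 / (1 + μ ^ 2) := by field_simp; ring
  rw [e1, log_div one_ne_zero (by positivity), log_div hμ.ne' (by positivity), log_one] at g1
  rw [e2, log_div (by positivity) (by positivity), log_div one_ne_zero (by positivity), log_one,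
    log_pow] at g2
  rw [two_log_two_mul_F₁, dual₁]
  push_cast at g2
  linarith

/-- As for `dual₁_le`: a coordinate of `(x, y, z, u)` is weighted by `l` to the number of its ones,
subject to `x ∨ y = z ∨ u`. The three values of `y` are the probabilities of `x = 1` given `x ∨ y =
1`, of `x = 0` given `y = 1`, and of `x ∨ y = 1`. -/
theorem dual₀_le {p α l : ℝ} (hp : p ∈ Ioo (0 : ℝ) 1) (hα : α ∈ A p) (hl : 0 < l) :
    dual₀ p l ≤ 3 * log 2 * F₀ p α := by
  obtain ⟨h1, h2, h3⟩ := mem_A.1 hα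
  obtain ⟨hp0, hp1⟩ := hp
  have g1 := mul_binEntropy_div_le (x := p) (T := α) (y := (1 + l) / (2 + l)) (by linarith)
    (by linarith) (by linarith) (by positivity) (by rw [div_lt_one (by positivity)]; linarith)
  have g2 := mul_binEntropy_div_le (x := α - p) (y := 1 / (1 + l)) hp0 (by linarith) (by linarith)
    (by positivity) (by rw [div_lt_one (by positivity)]; linarith)
  have g3 := mul_binEntropy_div_le (x := α) (T := 1)
    (y := (l * (2 + l)) ^ 2 / (1 + (2 * l + l ^ 2) ^ 2)) one_pos (by linarith) h3.le
    (by positivity) (by rw [div_lt_one (by positivity)]; linarith)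
  have e1 : 1 - (1 + l) / (2 + l) = 1 / (2 + l) := by field_simp; ring
  have e2 : 1 - 1 / (1 + l) = l / (1 + l) := by field_simp; ring
  have e3 : 1 - (l * (2 + l)) ^ 2 / (1 + (2 * l + l ^ 2) ^ 2) = 1 / (1 + (2 * l + l ^ 2) ^ 2) := by
    field_simp; ring
  rw [e1, log_div one_ne_zero (by positivity), log_div (by positivity) (by positivity),
    log_one] at g1
  rw [e2, log_div one_ne_zero (by positivity), log_div hl.ne' (by positivity), log_one] at g2
  rw [e3, log_div (by positivity) (by positivity), log_div one_ne_zero (by positivity), log_one,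
    log_pow, log_mul hl.ne' (by positivity), one_mul, div_one] at g3
  rw [three_log_two_mul_F₀, dual₀]
  push_cast at g3
  linarith

theorem exists_F₁_eq_dual₁ {p : ℝ} (hp : p ∈ Ioo (0 : ℝ) 1) :
    ∃ α ∈ A p, ∃ μ > 0, 2 * log 2 * F₁ p α = dual₁ p μ := by
  obtain ⟨hp0, hp1⟩ := hp
  -- `g α = 0` is the stationarity condition of `F₁ p` with denominators cleared; a root suffices,
  -- its uniqueness is not needed.
  set g : ℝ → ℝ := fun α => (α - p) ^ 3 - (1 - α) * (2 * p - α) ^ 2 with hg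
  have hm : p < min (2 * p) 1 := lt_min (by linarith) hp1
  have hgp : g p < 0 := by
    have : 0 < (1 - p) * p ^ 2 := mul_pos (by linarith) (by positivity)
    simp only [hg]; nlinarith
  have hgm : 0 < g (min (2 * p) 1) := by
    have h3 : 0 < (min (2 * p) 1 - p) ^ 3 := pow_pos (by linarith) 3
    have : (1 - min (2 * p) 1) * (2 * p - min (2 * p) 1) ^ 2 = 0 := by
      rcases min_choice (2 * p) 1 with h | h <;> simp [h]
    simp only [hg, this]; linarith
  obtain ⟨α, hα, hα0⟩ := intermediate_value_Ioo hm.le (f := g) (by fun_prop) ⟨hgp, hgm⟩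
  refine ⟨α, hα, ?_⟩
  obtain ⟨h1, h2, h3⟩ := mem_A.1 hα
  obtain ⟨d, hd⟩ : ∃ d, d = α - p := ⟨_, rfl⟩
  obtain ⟨e, he⟩ : ∃ e, e = 2 * p - α := ⟨_, rfl⟩
  obtain ⟨f, hf⟩ : ∃ f, f = 1 - α := ⟨_, rfl⟩
  have d0 : 0 < d := by linarith
  have e0 : 0 < e := by linarith
  have f0 : 0 < f := by linarith
  have hst : d ^ 3 = f * e ^ 2 := by simp only [hg] at hα0; rw [hd, he, hf]; linarith
  have hμ : 0 < e / d := by positivity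
  -- With `μ = e / d`, `1 / (1 + μ) = d / p`, and by `hst` also `μ ^ 2 / (1 + μ ^ 2) = d / (1 - p)`,
  -- so both uses of Gibbs' inequality are equalities.
  refine ⟨e / d, hμ, ?_⟩
  have l1 : log (e / d) = log e - log d := log_div e0.ne' d0.ne'
  have l2 : log (1 + e / d) = log p - log d := by
    rw [← log_div hp0.ne' d0.ne']; congr 1; field_simp; linarith
  have l3 : 3 * log d = log f + 2 * log e := by
    have := congrArg log hst
    rw [log_mul f0.ne' (by positivity), log_pow, log_pow] at this
    exact_mod_cast this
  have l4 : log (1 + (e / d) ^ 2) = log (1 - p) - log f := by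
    rw [← log_div (by linarith) f0.ne']; congr 1; field_simp
    have : 1 - p = d + f := by linarith
    rw [this]; nlinarith
  have s1 : p - (α - p) = e := by linarith
  have s2 : 1 - p - (α - p) = f := by linarith
  rw [two_log_two_mul_F₁, dual₁, mul_binEntropy_div_eq (by linarith) (by linarith),
    mul_binEntropy_div_eq (by linarith) (by linarith), l1, l2, l4, s1, s2, ← hd]
  have e1 : p = d + e := by linarith
  have e2 : 1 - p = d + f := by linarith
  have l5 : log e * d * 2 + log f * d = 3 * log d * d := by rw [l3]; ring
  generalize log p = lp, log (1 - p) = lq at *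
  rw [e2, e1]
  linarith

theorem exists_F₀_eq_dual₀ {p : ℝ} (hp : p ∈ Ioo (0 : ℝ) 1) :
    ∃ α ∈ A p, ∃ l > 0, 3 * log 2 * F₀ p α = dual₀ p l := by
  obtain ⟨hp0, hp1⟩ := hp
  -- Stationarity condition of `F₀ p`, cleared of denominators.
  set g : ℝ → ℝ := fun α => (α - p) ^ 4 - α * (1 - α) * (2 * p - α) ^ 2 with hg
  have hm : p < min (2 * p) 1 := lt_min (by linarith) hp1
  have hgp : g p < 0 := by
    have : 0 < p * (1 - p) * p ^ 2 := mul_pos (mul_pos hp0 (by linarith)) (by positivity)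
    simp only [hg]; nlinarith
  have hgm : 0 < g (min (2 * p) 1) := by
    have h3 : 0 < (min (2 * p) 1 - p) ^ 4 := pow_pos (by linarith) 4
    have : min (2 * p) 1 * (1 - min (2 * p) 1) * (2 * p - min (2 * p) 1) ^ 2 = 0 := by
      rcases min_choice (2 * p) 1 with h | h <;> simp [h]
    simp only [hg, this]; linarith
  obtain ⟨α, hα, hα0⟩ := intermediate_value_Ioo hm.le (f := g) (by fun_prop) ⟨hgp, hgm⟩
  refine ⟨α, hα, ?_⟩
  obtain ⟨h1, h2, h3⟩ := mem_A.1 hα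
  obtain ⟨d, hd⟩ : ∃ d, d = α - p := ⟨_, rfl⟩
  obtain ⟨e, he⟩ : ∃ e, e = 2 * p - α := ⟨_, rfl⟩
  obtain ⟨f, hf⟩ : ∃ f, f = 1 - α := ⟨_, rfl⟩
  have d0 : 0 < d := by linarith
  have e0 : 0 < e := by linarith
  have f0 : 0 < f := by linarith
  have a0 : 0 < α := by linarith
  have hst : d ^ 4 = α * f * e ^ 2 := by simp only [hg] at hα0; rw [hd, he, hf]; linarith
  have hl : 0 < e / d := by positivity
  refine ⟨e / d, hl, ?_⟩
  have l1 : log (e / d) = log e - log d := log_div e0.ne' d0.ne'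
  have l3 : 4 * log d = log α + log f + 2 * log e := by
    have := congrArg log hst
    rw [log_mul (by positivity) (by positivity), log_mul a0.ne' f0.ne', log_pow, log_pow] at this
    exact_mod_cast this
  have l4 : log (1 + (2 * (e / d) + (e / d) ^ 2) ^ 2) = - log f := by
    rw [← log_inv]; congr 1
    have : 2 * (e / d) + (e / d) ^ 2 = α * e / d ^ 2 := by
      field_simp; rw [show α = 2 * d + e by linarith]
    rw [this, div_pow, ← pow_mul, hst]
    field_simp
    linarith
  have s1 : p - (α - p) = e := by linarith
  have s3 : binEntropy α = - α * log α - f * log f := by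
    simp only [binEntropy, log_inv, ← hf]; ring
  rw [three_log_two_mul_F₀, dual₀, mul_binEntropy_div_eq (by linarith) (by linarith),
    mul_binEntropy_div_eq (by linarith) (by linarith), l1, l4, s1, s3, ← hd]
  have l5 : log f = 4 * log d - log α - 2 * log e := by linarith
  rw [l5]
  generalize log p = lp, log α = la at *
  rw [show f = 1 - α by linarith, show p = d + e by linarith, show α = 2 * d + e by linarith]
  ring

end UFFD

/-! ### Attained minima and upper semicontinuity in `p` -/

namespace UFFD

open Real Topology

theorem isLeast_R₁ {p : ℝ} (hp : p ∈ Ioo (0 : ℝ) 1) :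
    IsLeast (F₁ p '' A p) (R₁ p) ∧ ∃ μ > 0, 2 * log 2 * R₁ p = dual₁ p μ := by
  obtain ⟨α, hα, μ, hμ, h⟩ := exists_F₁_eq_dual₁ hp
  have h2 : 0 < 2 * log 2 := mul_pos two_pos (log_pos one_lt_two)
  have hl : IsLeast (F₁ p '' A p) (F₁ p α) := by
    refine ⟨mem_image_of_mem _ hα, ?_⟩
    rintro _ ⟨β, hβ, rfl⟩
    exact le_of_mul_le_mul_left (h.trans_le (dual₁_le hp hβ hμ)) h2
  have he : R₁ p = F₁ p α := hl.csInf_eq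
  exact ⟨he ▸ hl, μ, hμ, he ▸ h⟩

theorem isLeast_R₀ {p : ℝ} (hp : p ∈ Ioo (0 : ℝ) 1) :
    IsLeast (F₀ p '' A p) (R₀ p) ∧ ∃ l > 0, 3 * log 2 * R₀ p = dual₀ p l := by
  obtain ⟨α, hα, l, hl0, h⟩ := exists_F₀_eq_dual₀ hp
  have h2 : 0 < 3 * log 2 := mul_pos three_pos (log_pos one_lt_two)
  have hl : IsLeast (F₀ p '' A p) (F₀ p α) := by
    refine ⟨mem_image_of_mem _ hα, ?_⟩
    rintro _ ⟨β, hβ, rfl⟩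
    exact le_of_mul_le_mul_left (h.trans_le (dual₀_le hp hβ hl0)) h2
  have he : R₀ p = F₀ p α := hl.csInf_eq
  exact ⟨he ▸ hl, l, hl0, he ▸ h⟩

theorem dual₁_le_R₁ {p μ : ℝ} (hp : p ∈ Ioo (0 : ℝ) 1) (hμ : 0 < μ) :
    dual₁ p μ ≤ 2 * log 2 * R₁ p := by
  obtain ⟨α, hα, h⟩ := (isLeast_R₁ hp).1.1
  exact h ▸ dual₁_le hp hα hμ

theorem dual₀_le_R₀ {p l : ℝ} (hp : p ∈ Ioo (0 : ℝ) 1) (hl : 0 < l) :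
    dual₀ p l ≤ 3 * log 2 * R₀ p := by
  obtain ⟨α, hα, h⟩ := (isLeast_R₀ hp).1.1
  exact h ▸ dual₀_le hp hα hl

theorem continuous_h : Continuous h := by
  rw [funext h_eq_binEntropy_div]
  fun_prop

theorem continuousAt_F₁ {p : ℝ} (hp : p ∈ Ioo (0 : ℝ) 1) (α : ℝ) :
    ContinuousAt (fun p => F₁ p α) p := by
  have h1 : 1 - p ≠ 0 := (sub_pos.2 hp.2).ne'
  have h0 : p ≠ 0 := hp.1.ne'
  have := continuous_h
  unfold F₁
  have c1 : ContinuousAt (fun p : ℝ => h ((α - p) / p)) p :=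
    this.continuousAt.comp (by fun_prop (disch := assumption))
  have c2 : ContinuousAt (fun p : ℝ => h ((α - p) / (1 - p))) p :=
    this.continuousAt.comp (by fun_prop (disch := assumption))
  fun_prop

theorem continuousAt_F₀ {p : ℝ} (hp : p ∈ Ioo (0 : ℝ) 1) (α : ℝ) :
    ContinuousAt (fun p => F₀ p α) p := by
  have h0 : p ≠ 0 := hp.1.ne'
  have := continuous_h
  unfold F₀
  have c1 : ContinuousAt (fun p : ℝ => h ((α - p) / p)) p :=
    this.continuousAt.comp (by fun_prop (disch := assumption))
  fun_prop

theorem eventually_mem_A {p α : ℝ} (hα : α ∈ A p) : ∀ᶠ q in 𝓝 p, α ∈ A q := by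
  simp only [mem_A] at hα ⊢
  exact (eventually_lt_nhds hα.1).and
    (((continuous_const_mul 2).continuousAt.eventually_const_lt hα.2.1).and
      (.of_forall fun _ => hα.2.2))

/-- A minimizer `α` at `p` stays admissible for nearby `q`, so `R₁ q ≤ F₁ q α`, which is continuous
in `q`. -/
theorem upperSemicontinuousAt_R₁ {p : ℝ} (hp : p ∈ Ioo (0 : ℝ) 1) :
    UpperSemicontinuousAt R₁ p := by
  obtain ⟨α, hα, h⟩ := (isLeast_R₁ hp).1.1
  intro y hy
  rw [← h] at hy
  filter_upwards [(continuousAt_F₁ hp α).eventually_lt_const hy, eventually_mem_A hα,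
    isOpen_Ioo.mem_nhds hp] with q h1 h2 h3
  exact ((isLeast_R₁ h3).1.2 (mem_image_of_mem _ h2)).trans_lt h1

theorem upperSemicontinuousAt_R₀ {p : ℝ} (hp : p ∈ Ioo (0 : ℝ) 1) :
    UpperSemicontinuousAt R₀ p := by
  obtain ⟨α, hα, h⟩ := (isLeast_R₀ hp).1.1
  intro y hy
  rw [← h] at hy
  filter_upwards [(continuousAt_F₀ hp α).eventually_lt_const hy, eventually_mem_A hα,
    isOpen_Ioo.mem_nhds hp] with q h1 h2 h3
  exact ((isLeast_R₀ h3).1.2 (mem_image_of_mem _ h2)).trans_lt h1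

/-! ### Explicit estimates and the maximizer -/

/-- The value of `F₁` at `α = 2p - p²`, where two random columns are independent. -/
theorem R₁_le {p : ℝ} (hp : p ∈ Ioo (0 : ℝ) 1) : R₁ p ≤ (1 - p) * h p / 2 := by
  obtain ⟨h0, h1⟩ := hp
  have hα : 2 * p - p ^ 2 ∈ A p := by
    rw [mem_A]
    refine ⟨by nlinarith, by nlinarith, by nlinarith⟩
  refine ((isLeast_R₁ ⟨h0, h1⟩).1.2 (mem_image_of_mem _ hα)).trans_eq ?_
  have e1 : (2 * p - p ^ 2 - p) / p = 1 - p := by field_simp; ring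
  have e2 : (2 * p - p ^ 2 - p) / (1 - p) = p := by
    rw [div_eq_iff (by linarith)]; ring
  simp only [F₁, e1, e2]
  simp only [h_eq_binEntropy_div, binEntropy_one_sub]
  ring

theorem h_le_one (p : ℝ) : h p ≤ 1 := by
  rw [h_eq_binEntropy_div, div_le_one (log_pos one_lt_two)]
  exact binEntropy_le_log_two

theorem R₁_lt_of_le_eighth {p : ℝ} (h0 : 0 < p) (hp : p ≤ 1 / 8) : R₁ p < 0.3 := by
  have h2 : 0 < log 2 := log_pos one_lt_two
  have hm : h p ≤ h (1 / 8) := by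
    simp only [h_eq_binEntropy_div]
    gcongr
    exact binEntropy_strictMonoOn.monotoneOn ⟨h0.le, by linarith⟩ ⟨by norm_num, by norm_num⟩ hp
  have h8 : h (1 / 8) < 0.6 := by
    have l8 : log (1 / 8 : ℝ) = - 3 * log 2 := by
      rw [show (1 / 8 : ℝ) = (2 ^ 3)⁻¹ by norm_num, log_inv, log_pow]; push_cast; ring
    have l7 : log (1 - 1 / 8 : ℝ) = log 7 - 3 * log 2 := by
      rw [show (1 - 1 / 8 : ℝ) = 7 / 2 ^ 3 by norm_num, log_div (by norm_num) (by norm_num), log_pow]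
      push_cast; ring
    have l : 11 * log 2 < 4 * log 7 := by
      have : log ((2 : ℝ) ^ 11) < log (7 ^ 4) := log_lt_log (by norm_num) (by norm_num)
      rw [log_pow, log_pow] at this
      exact_mod_cast this
    rw [h_eq_binEntropy_div, div_lt_iff₀ h2, binEntropy, log_inv, log_inv, l8, l7]
    linarith
  have hh : 0 ≤ h p := by
    rw [h_eq_binEntropy_div]
    exact div_nonneg (binEntropy_nonneg h0.le (by linarith)) h2.le
  have := R₁_le ⟨h0, by linarith⟩
  nlinarith

theorem R₁_le_of_two_fifths_le {p : ℝ} (h1 : p < 1) (hp : 2 / 5 ≤ p) : R₁ p ≤ 0.3 := by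
  have := R₁_le ⟨by linarith, h1⟩
  nlinarith [h_le_one p]

/-- By concavity and `h 0 = 0`, the slope `h p / p` is decreasing. -/
theorem div_mul_h_le {p b : ℝ} (hp : 0 < p) (hpb : p ≤ b) (hb : b ≤ 1) :
    p / b * h b ≤ h p := by
  have hb0 : 0 < b := hp.trans_le hpb
  have := strictConcave_binEntropy.concaveOn.2 (⟨hb0.le, hb⟩ : b ∈ Icc (0 : ℝ) 1)
    (⟨le_rfl, zero_le_one⟩ : (0 : ℝ) ∈ Icc (0 : ℝ) 1)
    (show 0 ≤ p / b by positivity) (show 0 ≤ 1 - p / b by rw [sub_nonneg, div_le_one hb0]; exact hpb)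
    (by ring)
  simp only [smul_eq_mul, mul_zero, add_zero, binEntropy_zero, div_mul_cancel₀ p hb0.ne'] at this
  rw [h_eq_binEntropy_div, h_eq_binEntropy_div, ← mul_div_assoc]
  exact div_le_div_of_nonneg_right this (log_pos one_lt_two).le

/-- This makes the covering requirement of the random code automatic for every `r < R₁ p`. By
`R₁_le` it suffices that `h p / p > 8 / (3 + p)`; the slope bounds `2.7` on `[1/8, 1/3]` and `2.425`
on `[1/3, 2/5]` give this. -/
theorem R₁_lt_two_mul {p : ℝ} (hp : p ∈ Icc (1 / 8 : ℝ) (2 / 5)) : R₁ p < 2 * (h p - 2 * p) := by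
  obtain ⟨h0, h1⟩ := hp
  have h2 : 0 < log 2 := log_pos one_lt_two
  refine (R₁_le ⟨by linarith, by linarith⟩).trans_lt ?_
  rcases le_total p (1 / 3) with h3 | h3
  · have hb : 0.9 ≤ h (1 / 3) := by
      have l : 47 * log 2 ≤ 30 * log 3 := by
        have : log ((2 : ℝ) ^ 47) ≤ log (3 ^ 30) := log_le_log (by norm_num) (by norm_num)
        rw [log_pow, log_pow] at this
        exact_mod_cast this
      rw [h_eq_binEntropy_div, le_div_iff₀ h2, binEntropy, log_inv, log_inv,
        show (1 - 1 / 3 : ℝ) = 2 / 3 by norm_num, log_div two_ne_zero three_ne_zero,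
        log_div one_ne_zero three_ne_zero, log_one]
      linarith
    have := div_mul_h_le (by linarith) h3 (by norm_num)
    have h4 : 2.7 * p ≤ h p := by nlinarith
    nlinarith
  · have hb : 0.97 ≤ h (2 / 5) := by
      have l : 137 * log 2 + 60 * log 3 ≤ 100 * log 5 := by
        have : log ((2 : ℝ) ^ 137 * 3 ^ 60) ≤ log (5 ^ 100) := log_le_log (by norm_num) (by norm_num)
        rw [log_mul (by norm_num) (by norm_num), log_pow, log_pow, log_pow] at this
        exact_mod_cast this
      rw [h_eq_binEntropy_div, le_div_iff₀ h2, binEntropy, log_inv, log_inv,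
        show (1 - 2 / 5 : ℝ) = 3 / 5 by norm_num, log_div two_ne_zero (by norm_num),
        log_div three_ne_zero (by norm_num)]
      linarith
    have := div_mul_h_le (by linarith) h1 (by norm_num)
    have h4 : 2.425 * p ≤ h p := by nlinarith
    nlinarith

theorem binEntropy_five_sixteenths :
    16 * binEntropy (5 / 16) = 64 * log 2 - 5 * log 5 - 11 * log 11 := by
  rw [binEntropy, log_inv, log_inv, show (1 - 5 / 16 : ℝ) = 11 / 16 by norm_num,
    log_div (by norm_num) (by norm_num), log_div (by norm_num) (by norm_num),
    show (16 : ℝ) = 2 ^ 4 by norm_num, log_pow]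
  push_cast
  ring

-- Any `μ` gives a lower bound through the dual. With `μ = 5/8` the terms in `log 5` cancel, and
-- what remains is a comparison of integer powers; the factor `55` makes the rounding of the
-- exponent of `2` harmless.
set_option exponentiation.threshold 20000 in
theorem le_R₁_five_sixteenths : 0.3017 ≤ R₁ (5 / 16) := by
  have h2 : 0 < log 2 := log_pos one_lt_two
  have h3 := dual₁_le_R₁ (p := 5 / 16) (μ := 5 / 8) ⟨by norm_num, by norm_num⟩ (by norm_num)
  have key : 55 * (22 * log 11 + 11 * log 89 + 10 * log 13) ≤ 10139 * log 2 := by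
    have : log (((11 : ℝ) ^ 22 * 89 ^ 11 * 13 ^ 10) ^ 55) ≤ log (2 ^ 10139) :=
      log_le_log (by positivity) (by norm_num)
    rw [log_pow, log_mul (by positivity) (by positivity), log_mul (by positivity) (by positivity),
      log_pow, log_pow, log_pow, log_pow] at this
    exact_mod_cast this
  have e := binEntropy_five_sixteenths
  have l1 : log (5 / 8 : ℝ) = log 5 - 3 * log 2 := by
    rw [log_div (by norm_num) (by norm_num), show (8 : ℝ) = 2 ^ 3 by norm_num, log_pow]
    push_cast; ring
  have l2 : log (1 + 5 / 8 : ℝ) = log 13 - 3 * log 2 := by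
    rw [show (1 + 5 / 8 : ℝ) = 13 / 2 ^ 3 by norm_num, log_div (by norm_num) (by norm_num), log_pow]
    push_cast; ring
  have l3 : log (1 + (5 / 8) ^ 2 : ℝ) = log 89 - 6 * log 2 := by
    rw [show (1 + (5 / 8) ^ 2 : ℝ) = 89 / 2 ^ 6 by norm_num, log_div (by norm_num) (by norm_num),
      log_pow]
    push_cast; ring
  rw [dual₁, l1, l2, l3] at h3
  have : 2 * log 2 * 0.3017 ≤ 2 * log 2 * R₁ (5 / 16) := by linarith
  exact le_of_mul_le_mul_left this (by positivity)

theorem le_R₀_five_sixteenths : 0.3017 ≤ R₀ (5 / 16) := by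
  have h2 : 0 < log 2 := log_pos one_lt_two
  have h3 := dual₀_le_R₀ (p := 5 / 16) (l := 1 / 2) ⟨by norm_num, by norm_num⟩ (by norm_num)
  have key : 3 * (5 * log 5 + 11 * log 11 + 4 * log 41) ≤ 214 * log 2 := by
    have : log (((5 : ℝ) ^ 5 * 11 ^ 11 * 41 ^ 4) ^ 3) ≤ log (2 ^ 214) :=
      log_le_log (by positivity) (by norm_num)
    rw [log_pow, log_mul (by positivity) (by positivity), log_mul (by positivity) (by positivity),
      log_pow, log_pow, log_pow, log_pow] at this
    exact_mod_cast this
  have e := binEntropy_five_sixteenths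
  have l1 : log (1 / 2 : ℝ) = - log 2 := by rw [one_div, log_inv]
  have l3 : log (1 + (2 * (1 / 2) + (1 / 2) ^ 2) ^ 2 : ℝ) = log 41 - 4 * log 2 := by
    rw [show (1 + (2 * (1 / 2) + (1 / 2) ^ 2) ^ 2 : ℝ) = 41 / 2 ^ 4 by norm_num,
      log_div (by norm_num) (by norm_num), log_pow]
    push_cast; ring
  rw [dual₀, l1, l3] at h3
  have : 3 * log 2 * 0.3017 ≤ 3 * log 2 * R₀ (5 / 16) := by linarith
  exact le_of_mul_le_mul_left this (by positivity)

/-- The maximum of `min (R₀ p) (R₁ p)` is attained, at a point of `[1/8, 2/5]`. -/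
theorem exists_maximizer : ∃ p ∈ Icc (1 / 8 : ℝ) (2 / 5), 0.3017 ≤ min (R₀ p) (R₁ p) ∧
    ∀ q ∈ Ioo (0 : ℝ) 1, min (R₀ q) (R₁ q) ≤ min (R₀ p) (R₁ p) := by
  have husc : UpperSemicontinuousOn (fun p => min (R₀ p) (R₁ p)) (Icc (1 / 8 : ℝ) (2 / 5)) := by
    intro p hp y hy
    have hp' : p ∈ Ioo (0 : ℝ) 1 := ⟨by linarith [hp.1], by linarith [hp.2]⟩
    apply Filter.Eventually.filter_mono nhdsWithin_le_nhds
    rcases min_lt_iff.1 hy with h | h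
    · filter_upwards [upperSemicontinuousAt_R₀ hp' y h] with q hq using min_lt_of_left_lt hq
    · filter_upwards [upperSemicontinuousAt_R₁ hp' y h] with q hq using min_lt_of_right_lt hq
  obtain ⟨p, hp, hmax⟩ := husc.exists_isMaxOn ⟨1 / 8, by norm_num⟩ isCompact_Icc
  have h5 : 0.3017 ≤ min (R₀ p) (R₁ p) :=
    (le_min le_R₀_five_sixteenths le_R₁_five_sixteenths).trans
      (hmax (show (5 / 16 : ℝ) ∈ Icc (1 / 8 : ℝ) (2 / 5) by norm_num))
  refine ⟨p, hp, h5, fun q hq => ?_⟩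
  rcases le_total q (1 / 8) with h | h
  · have := (min_le_right (R₀ q) _).trans_lt (R₁_lt_of_le_eighth hq.1 h)
    linarith
  rcases le_total (2 / 5) q with h' | h'
  · have := (min_le_right (R₀ q) _).trans (R₁_le_of_two_fifths_le hq.2 h')
    linarith
  exact hmax ⟨h, h'⟩

end UFFD

/-! ### Random subsets and alteration -/

namespace UFFD

open Finset

section Alteration

variable {β : Type*} [DecidableEq β]

/-- The probability that a random subset of `s`, containing each element independently with
probability `ρ`, equals `S`. -/
def subsetWeight (ρ : ℝ) (s S : Finset β) : ℝ := (∏ _a ∈ S, ρ) * ∏ _a ∈ s \ S, (1 - ρ)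

/-- The expectation of a product over independent choices factors; every moment below is an
instance. -/
theorem sum_subsetWeight_mul (ρ : ℝ) (s : Finset β) (f g : β → ℝ) :
    ∑ S ∈ s.powerset, subsetWeight ρ s S * ((∏ a ∈ S, f a) * ∏ a ∈ s \ S, g a) =
      ∏ a ∈ s, (ρ * f a + (1 - ρ) * g a) := by
  rw [Finset.prod_add]
  refine sum_congr rfl fun S _ => ?_
  rw [subsetWeight, prod_mul_distrib, prod_mul_distrib]
  ring

theorem sum_subsetWeight (ρ : ℝ) (s : Finset β) :
    ∑ S ∈ s.powerset, subsetWeight ρ s S = 1 := by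
  simpa using sum_subsetWeight_mul ρ s (fun _ => 1) (fun _ => 1)

theorem sum_subsetWeight_superset (ρ : ℝ) {s e : Finset β} (he : e ⊆ s) :
    ∑ S ∈ s.powerset, subsetWeight ρ s S * (if e ⊆ S then 1 else 0) = ρ ^ #e := by
  have := sum_subsetWeight_mul ρ s (fun _ => 1) (fun a => if a ∈ e then 0 else 1)
  calc _ = ∑ S ∈ s.powerset, subsetWeight ρ s S *
        ((∏ a ∈ S, (1 : ℝ)) * ∏ a ∈ s \ S, if a ∈ e then 0 else 1) := by
        refine sum_congr rfl fun S hS => ?_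
        congr 1
        rw [prod_const_one, one_mul]
        split_ifs with h
        · rw [prod_eq_one]
          intro a ha
          rw [if_neg fun hae => (Finset.mem_sdiff.1 ha).2 (h hae)]
        · obtain ⟨a, hae, haS⟩ := Finset.not_subset.1 h
          symm
          exact prod_eq_zero (i := a) (Finset.mem_sdiff.2 ⟨he hae, haS⟩) (if_pos hae)
    _ = ∏ a ∈ s, if a ∈ e then ρ else 1 := by
        rw [this]
        refine prod_congr rfl fun a _ => ?_
        split_ifs <;> ring
    _ = ρ ^ #e := by
        rw [prod_ite_mem, Finset.inter_eq_right.2 he, prod_const]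

theorem sum_subsetWeight_card (ρ : ℝ) (s : Finset β) :
    ∑ S ∈ s.powerset, subsetWeight ρ s S * #S = ρ * #s := by
  calc _ = ∑ S ∈ s.powerset, ∑ a ∈ s, subsetWeight ρ s S * (if {a} ⊆ S then 1 else 0) := by
        refine sum_congr rfl fun S hS => ?_
        rw [← mul_sum]
        simp [Finset.inter_eq_right.2 (Finset.mem_powerset.1 hS)]
    _ = ∑ a ∈ s, ρ := by
        rw [sum_comm]
        refine sum_congr rfl fun a ha => ?_
        simpa using sum_subsetWeight_superset ρ (Finset.singleton_subset_iff.2 ha)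
    _ = ρ * #s := by simp [mul_comm]

theorem sum_subsetWeight_two_pow (ρ : ℝ) {s v : Finset β} (hv : v ⊆ s) :
    ∑ S ∈ s.powerset, subsetWeight ρ s S * 2 ^ #(S ∩ v) = (1 + ρ) ^ #v := by
  have := sum_subsetWeight_mul ρ s (fun a => if a ∈ v then 2 else 1) (fun _ => 1)
  calc _ = ∑ S ∈ s.powerset, subsetWeight ρ s S *
        ((∏ a ∈ S, if a ∈ v then 2 else 1) * ∏ a ∈ s \ S, (1 : ℝ)) := by
        refine sum_congr rfl fun S hS => ?_
        rw [prod_const_one, mul_one, prod_ite_mem, prod_const]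
    _ = ∏ a ∈ s, if a ∈ v then 1 + ρ else 1 := by
        rw [this]
        refine prod_congr rfl fun a _ => ?_
        split_ifs <;> ring
    _ = (1 + ρ) ^ #v := by
        rw [prod_ite_mem, Finset.inter_eq_right.2 hv, prod_const]

/-- The alteration method: a large subset of `s` that contains no member of `E` and meets each
member of `V` in at most `m` points. -/
theorem exists_large_subset (s : Finset β) (E V : Finset (Finset β)) {ρ L : ℝ} {m : ℕ}
    (h0 : 0 ≤ ρ) (h1 : ρ ≤ 1) (hE : ∀ e ∈ E, e.Nonempty ∧ e ⊆ s) (hV : ∀ v ∈ V, v ⊆ s)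
    (hL0 : 0 ≤ L)
    (hL : L + ∑ e ∈ E, ρ ^ #e + ∑ v ∈ V, #s * (1 + ρ) ^ #v / 2 ^ m < ρ * #s) :
    ∃ S ⊆ s, L < #S ∧ (∀ e ∈ E, ¬ e ⊆ S) ∧ ∀ v ∈ V, #(S ∩ v) ≤ m := by
  -- The last sum is a penalty: if some `#(S ∩ v)` exceeds `m`, its term alone is at least `#s ≥
  -- #S`, which forces `Φ S ≤ 0`. Thus `Φ S > L ≥ 0` handles all of `V` at once.
  set Φ : Finset β → ℝ := fun S => #S - ∑ e ∈ E, (if e ⊆ S then 1 else 0)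
    - ∑ v ∈ V, (#s : ℝ) / 2 ^ m * 2 ^ #(S ∩ v) with hΦ
  have hsum : ∑ S ∈ s.powerset, subsetWeight ρ s S * Φ S =
      ρ * #s - ∑ e ∈ E, ρ ^ #e - ∑ v ∈ V, #s * (1 + ρ) ^ #v / 2 ^ m := by
    simp only [hΦ, mul_sub, sum_sub_distrib, sum_subsetWeight_card, mul_sum]
    congr 1
    · congr 1
      rw [sum_comm]
      exact sum_congr rfl fun e he => sum_subsetWeight_superset ρ (hE e he).2
    · rw [sum_comm]
      refine sum_congr rfl fun v hv => ?_
      rw [mul_div_right_comm, ← sum_subsetWeight_two_pow ρ (hV v hv), mul_sum]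
      exact sum_congr rfl fun S _ => by ring
  obtain ⟨S, hS, hLS⟩ : ∃ S ∈ s.powerset, subsetWeight ρ s S * L < subsetWeight ρ s S * Φ S := by
    apply exists_lt_of_sum_lt
    rw [← sum_mul, sum_subsetWeight, hsum]
    linarith
  have hw : 0 ≤ subsetWeight ρ s S :=
    mul_nonneg (prod_nonneg fun _ _ => h0) (prod_nonneg fun _ _ => by linarith)
  replace hLS : L < Φ S := lt_of_mul_lt_mul_left hLS hw
  rw [Finset.mem_powerset] at hS
  have hSs : (#S : ℝ) ≤ #s := by exact_mod_cast Finset.card_le_card hS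
  have hE0 : ∑ e ∈ E, (if e ⊆ S then 1 else 0 : ℝ) = #{e ∈ E | e ⊆ S} := by simp
  have hV0 : ∀ v ∈ V, 0 ≤ (#s : ℝ) / 2 ^ m * 2 ^ #(S ∩ v) := fun v _ => by positivity
  simp only [hΦ, hE0] at hLS
  have hm : ∀ v ∈ V, #(S ∩ v) ≤ m := by
    intro v hv
    by_contra! hlt
    have h2 : (#s : ℝ) ≤ #s / 2 ^ m * 2 ^ #(S ∩ v) := by
      rw [div_mul_eq_mul_div, le_div_iff₀ (by positivity)]
      gcongr
      exact one_le_two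
    have h3 := single_le_sum hV0 hv
    have : (0 : ℝ) ≤ #{e ∈ E | e ⊆ S} := by positivity
    linarith
  choose x hx using fun e (he : e ∈ E) => (hE e he).1
  -- One point of each bad `e ⊆ S` is deleted; this costs at most the number of such `e`, already
  -- subtracted in `Φ`.
  set X : Finset β := (E.filter (· ⊆ S)).attach.image
    fun e => x e.1 (Finset.mem_filter.1 e.2).1 with hX
  have hXc : #X ≤ #{e ∈ E | e ⊆ S} := card_image_le.trans (by simp)
  refine ⟨S \ X, sdiff_subset.trans hS, ?_, ?_, ?_⟩
  · have h3 := sum_nonneg hV0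
    have h4 : (#S : ℝ) - #X ≤ #(S \ X) := by
      rw [sub_le_iff_le_add]
      exact_mod_cast card_le_card_sdiff_add_card
    have h5 : (#X : ℝ) ≤ #{e ∈ E | e ⊆ S} := by exact_mod_cast hXc
    linarith
  · intro e he heS
    have h1 : e ∈ E.filter (· ⊆ S) := Finset.mem_filter.2 ⟨he, heS.trans sdiff_subset⟩
    have h2 := (Finset.mem_sdiff.1 (heS (hx e he))).2
    exact h2 (Finset.mem_image.2 ⟨⟨e, h1⟩, mem_attach _ _, rfl⟩)
  · intro v hv
    exact (Finset.card_le_card (by gcongr; exact sdiff_subset)).trans (hm v hv)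

end Alteration

end UFFD

/-! ### Counting coincidences, and codes of constant weight -/

namespace UFFD

open Finset

/-- The number of ones of a binary vector. -/
def weight {t : ℕ} (x : Fin t → Bool) : ℕ := #{i | x i = true}

/-- The binary vectors of length `t` and weight `w`. -/
def weightVectors (t w : ℕ) : Finset (Fin t → Bool) := {x | weight x = w}

@[simp] theorem mem_weightVectors {t w : ℕ} {x : Fin t → Bool} :
    x ∈ weightVectors t w ↔ weight x = w := by simp [weightVectors]

theorem card_weightVectors (t w : ℕ) : #(weightVectors t w) = t.choose w := by
  conv_rhs => rw [← card_fin t, ← card_powersetCard]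
  refine card_nbij' (fun x => univ.filter fun i => x i = true) (fun S i => decide (i ∈ S)) ?_ ?_ ?_ ?_
  · intro x hx
    simpa [weight] using hx
  · intro S hS
    simpa [weight] using hS
  · intro x _
    ext i
    simp
  · intro S _
    ext i
    simp

theorem weight_mono {t : ℕ} {x y : Fin t → Bool} (h : x ≤ y) : weight x ≤ weight y :=
  Finset.card_le_card fun i hi => by
    simp only [Finset.mem_filter, Finset.mem_univ, true_and] at hi ⊢
    exact h i hi

theorem eq_of_le_of_weight_eq {t : ℕ} {x y : Fin t → Bool} (h : x ≤ y)
    (hw : weight x = weight y) : x = y := by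
  have hs : univ.filter (fun i => x i = true) = univ.filter (fun i => y i = true) :=
    Finset.eq_of_subset_of_card_le (fun i hi => by
      simp only [Finset.mem_filter, Finset.mem_univ, true_and] at hi ⊢
      exact h i hi) hw.ge
  ext i
  have := Finset.ext_iff.1 hs i
  simp only [Finset.mem_filter, Finset.mem_univ, true_and] at this
  exact Bool.eq_iff_iff.2 this

theorem weight_sup_le {t : ℕ} (x y : Fin t → Bool) : weight (x ⊔ y) ≤ weight x + weight y := by
  refine (Finset.card_le_card fun i hi => ?_).trans (card_union_le _ _)
  simpa using hi

theorem prod_ite_eq_pow_weight {t : ℕ} (x : Fin t → Bool) (a b : ℝ) :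
    ∏ i, (if x i = true then a else b) = a ^ weight x * b ^ (t - weight x) := by
  rw [prod_ite, prod_const, prod_const, weight]
  congr 2
  have := Finset.card_filter_add_card_filter_not (s := (univ : Finset (Fin t))) (fun i => x i = true)
  rw [card_univ, Fintype.card_fin] at this
  omega

theorem pow_weight {t : ℕ} (x : Fin t → Bool) (a : ℝ) :
    a ^ weight x = ∏ i, (if x i = true then a else 1) := by
  rw [prod_ite_eq_pow_weight, one_pow, mul_one]

instance {t : ℕ} (U : Fin t → Bool) : DecidablePred (· ≤ U) := fun x =>
  decidable_of_iff (∀ i, x i ≤ U i) Iff.rfl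

theorem card_filter_le_le {t w : ℕ} (U : Fin t → Bool) :
    #{x ∈ weightVectors t w | x ≤ U} ≤ 2 ^ weight U := by
  have h1 : #(Fintype.piFinset fun i => if U i = true then univ else {false}) = 2 ^ weight U := by
    rw [Fintype.card_piFinset, weight, ← prod_const, prod_filter]
    refine prod_congr rfl fun i _ => ?_
    cases U i <;> rfl
  rw [← h1]
  refine Finset.card_le_card fun x hx => Fintype.mem_piFinset.2 fun i => ?_
  have := (Finset.mem_filter.1 hx).2 i
  cases hU : U i
  · rw [hU] at this
    simpa using le_bot_iff.1 this
  · simp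

/-- The pairs `(y, z)` of vectors of weight `w` with `x ∨ y = x ∨ z`. -/
def supPairs {t : ℕ} (w : ℕ) (x : Fin t → Bool) : Finset ((Fin t → Bool) × (Fin t → Bool)) :=
  {q ∈ weightVectors t w ×ˢ weightVectors t w | x ⊔ q.1 = x ⊔ q.2}

/-- The weight of a coordinate in generating functions of `supPairs`. -/
def pairWeight (μ : ℝ) (a : Bool) (b : Bool × Bool) : ℝ :=
  if (a || b.1) = (a || b.2) then (if b.1 = true then μ else 1) * (if b.2 = true then μ else 1)
  else 0

theorem pairWeight_nonneg {μ : ℝ} (hμ : 0 ≤ μ) (a : Bool) (b : Bool × Bool) :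
    0 ≤ pairWeight μ a b := by
  unfold pairWeight
  split_ifs <;> positivity

theorem sum_pairWeight (μ : ℝ) (a : Bool) :
    ∑ b, pairWeight μ a b = if a = true then (1 + μ) ^ 2 else 1 + μ ^ 2 := by
  cases a <;> simp [pairWeight, Fintype.sum_prod_type] <;> ring

/-- Each pair contributes exactly `μ ^ (2 * w)` to a generating function. Dropping the weight
restriction on `y` and `z` only enlarges the sum, which then factors over coordinates. -/
theorem card_supPairs_mul_le {t w : ℕ} {x : Fin t → Bool} (hx : weight x = w) {μ : ℝ}
    (hμ : 0 < μ) :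
    (#(supPairs w x) : ℝ) * μ ^ (2 * w) ≤ (1 + μ) ^ (2 * w) * (1 + μ ^ 2) ^ (t - w) := by
  set mk : (Fin t → Bool) × (Fin t → Bool) → Fin t → Bool × Bool := fun q i => (q.1 i, q.2 i)
    with hmk
  have hinj : Function.Injective mk := by
    intro q q' h
    refine Prod.ext (funext fun i => ?_) (funext fun i => ?_)
    · exact congrArg Prod.fst (congrFun h i)
    · exact congrArg Prod.snd (congrFun h i)
  calc (#(supPairs w x) : ℝ) * μ ^ (2 * w) =
        ∑ q ∈ supPairs w x, ∏ i, pairWeight μ (x i) (mk q i) := by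
        rw [← nsmul_eq_mul, ← sum_const]
        refine sum_congr rfl fun q hq => ?_
        simp only [supPairs, Finset.mem_filter, Finset.mem_product, mem_weightVectors] at hq
        obtain ⟨⟨h1, h2⟩, h3⟩ := hq
        have h4 : ∀ i, pairWeight μ (x i) (mk q i) =
            (if q.1 i = true then μ else 1) * (if q.2 i = true then μ else 1) := fun i =>
          if_pos (congrFun h3 i)
        simp only [h4, prod_mul_distrib, ← pow_weight, h1, h2]
        ring
    _ = ∑ g ∈ (supPairs w x).image mk, ∏ i, pairWeight μ (x i) (g i) :=
        (sum_image (f := fun g => ∏ i, pairWeight μ (x i) (g i)) hinj.injOn).symm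
    _ ≤ ∑ g : Fin t → Bool × Bool, ∏ i, pairWeight μ (x i) (g i) :=
        sum_le_sum_of_subset_of_nonneg (Finset.subset_univ _)
          fun g _ _ => prod_nonneg fun i _ => pairWeight_nonneg hμ.le _ _
    _ = ∏ i, ∑ b, pairWeight μ (x i) b := (Fintype.prod_sum _).symm
    _ = _ := by
        simp only [sum_pairWeight, prod_ite_eq_pow_weight, hx, pow_mul]

/-- The quadruples of vectors of weight `w` with `x ∨ y = z ∨ u`. -/
def supQuadruples (t w : ℕ) :
    Finset ((Fin t → Bool) × (Fin t → Bool) × (Fin t → Bool) × (Fin t → Bool)) :=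
  {q ∈ weightVectors t w ×ˢ weightVectors t w ×ˢ weightVectors t w ×ˢ weightVectors t w |
    q.1 ⊔ q.2.1 = q.2.2.1 ⊔ q.2.2.2}

/-- The weight of a coordinate in generating functions of `supQuadruples`. -/
def quadrupleWeight (l : ℝ) (b : Bool × Bool × Bool × Bool) : ℝ :=
  if (b.1 || b.2.1) = (b.2.2.1 || b.2.2.2) then
    (if b.1 = true then l else 1) * (if b.2.1 = true then l else 1) *
      ((if b.2.2.1 = true then l else 1) * (if b.2.2.2 = true then l else 1))
  else 0

theorem quadrupleWeight_nonneg {l : ℝ} (hl : 0 ≤ l) (b : Bool × Bool × Bool × Bool) :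
    0 ≤ quadrupleWeight l b := by
  have h : ∀ a : Bool, 0 ≤ if a = true then l else 1 := fun a => by split_ifs <;> positivity
  unfold quadrupleWeight
  exact ite_nonneg (mul_nonneg (mul_nonneg (h _) (h _)) (mul_nonneg (h _) (h _))) le_rfl

theorem sum_quadrupleWeight (l : ℝ) :
    ∑ b, quadrupleWeight l b = 1 + (2 * l + l ^ 2) ^ 2 := by
  simp [quadrupleWeight, Fintype.sum_prod_type]
  ring

theorem card_supQuadruples_mul_le (t w : ℕ) {l : ℝ} (hl : 0 < l) :
    (#(supQuadruples t w) : ℝ) * l ^ (4 * w) ≤ (1 + (2 * l + l ^ 2) ^ 2) ^ t := by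
  set mk : (Fin t → Bool) × (Fin t → Bool) × (Fin t → Bool) × (Fin t → Bool) →
    Fin t → Bool × Bool × Bool × Bool := fun q i => (q.1 i, q.2.1 i, q.2.2.1 i, q.2.2.2 i) with hmk
  have hinj : Function.Injective mk := by
    intro q q' h
    have h' := fun i => congrFun h i
    simp only [hmk, Prod.mk.injEq] at h'
    exact Prod.ext (funext fun i => (h' i).1) (Prod.ext (funext fun i => (h' i).2.1)
      (Prod.ext (funext fun i => (h' i).2.2.1) (funext fun i => (h' i).2.2.2)))
  calc (#(supQuadruples t w) : ℝ) * l ^ (4 * w) =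
        ∑ q ∈ supQuadruples t w, ∏ i, quadrupleWeight l (mk q i) := by
        rw [← nsmul_eq_mul, ← sum_const]
        refine sum_congr rfl fun q hq => ?_
        simp only [supQuadruples, Finset.mem_filter, Finset.mem_product, mem_weightVectors] at hq
        obtain ⟨⟨h1, h2, h3, h4⟩, h5⟩ := hq
        have h6 : ∀ i, quadrupleWeight l (mk q i) =
            (if q.1 i = true then l else 1) * (if q.2.1 i = true then l else 1) *
            ((if q.2.2.1 i = true then l else 1) * (if q.2.2.2 i = true then l else 1)) := fun i =>
          if_pos (congrFun h5 i)
        simp only [h6, prod_mul_distrib, ← pow_weight, h1, h2, h3, h4]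
        ring
    _ = ∑ g ∈ (supQuadruples t w).image mk, ∏ i, quadrupleWeight l (g i) :=
        (sum_image (f := fun g => ∏ i, quadrupleWeight l (g i)) hinj.injOn).symm
    _ ≤ ∑ g : Fin t → Bool × Bool × Bool × Bool, ∏ i, quadrupleWeight l (g i) :=
        sum_le_sum_of_subset_of_nonneg (Finset.subset_univ _)
          fun g _ _ => prod_nonneg fun i _ => quadrupleWeight_nonneg hl.le _
    _ = (∑ b, quadrupleWeight l b) ^ t := (Fintype.sum_pow _ _).symm
    _ = _ := by rw [sum_quadrupleWeight]

theorem sup_eq_sup_imp {t w : ℕ} {S : Finset (Fin t → Bool)} (hS : S ⊆ weightVectors t w)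
    (h : ∀ x ∈ S, ∀ y ∈ S, ∀ z ∈ S, x ≠ y → x ≠ z → y ≠ z → x ⊔ y ≠ x ⊔ z)
    {x y z : Fin t → Bool} (hx : x ∈ S) (hy : y ∈ S) (hz : z ∈ S) (he : x ⊔ y = x ⊔ z) :
    y = z := by
  have hw : ∀ {a b}, a ∈ S → b ∈ S → a ≤ b → a = b := fun ha hb hab =>
    eq_of_le_of_weight_eq hab
      ((mem_weightVectors.1 (hS ha)).trans (mem_weightVectors.1 (hS hb)).symm)
  by_contra hyz
  by_cases hxy : x = y
  · subst hxy
    rw [sup_idem] at he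
    exact hyz (hw hz hx (he ▸ le_sup_right)).symm
  by_cases hxz : x = z
  · subst hxz
    rw [sup_idem] at he
    exact hyz (hw hy hx (he ▸ le_sup_right))
  exact h x hx y hy z hz hxy hxz hyz he

/-- Vectors of equal weight form an antichain, so any coincidence with repeated vectors is trivial
or reduces to the triple condition. -/
theorem pair_eq_pair_of_sup_eq_sup {t w : ℕ} {S : Finset (Fin t → Bool)}
    (hS : S ⊆ weightVectors t w)
    (h3 : ∀ x ∈ S, ∀ y ∈ S, ∀ z ∈ S, x ≠ y → x ≠ z → y ≠ z → x ⊔ y ≠ x ⊔ z)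
    (h4 : ∀ x ∈ S, ∀ y ∈ S, ∀ z ∈ S, ∀ u ∈ S, ({x, y, z, u} : Finset _).card = 4 →
      x ⊔ y ≠ z ⊔ u)
    {x y z u : Fin t → Bool} (hx : x ∈ S) (hy : y ∈ S) (hz : z ∈ S) (hu : u ∈ S)
    (he : x ⊔ y = z ⊔ u) : ({x, y} : Finset (Fin t → Bool)) = {z, u} := by
  have hw : ∀ {a b}, a ∈ S → b ∈ S → a ≤ b → a = b := fun ha hb hab =>
    eq_of_le_of_weight_eq hab
      ((mem_weightVectors.1 (hS ha)).trans (mem_weightVectors.1 (hS hb)).symm)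
  have key := @sup_eq_sup_imp t w S hS h3
  by_cases h1 : x = y
  · subst h1
    rw [sup_idem] at he
    rw [hw hz hx (he ▸ le_sup_left), hw hu hx (he ▸ le_sup_right)]
  by_cases h2 : z = u
  · subst h2
    rw [sup_idem] at he
    rw [hw hx hz (he ▸ le_sup_left), hw hy hz (he ▸ le_sup_right)]
  by_cases h5 : x = z
  · subst h5
    rw [key hx hy hu he]
  by_cases h6 : x = u
  · subst h6
    rw [key hx hy hz (he.trans (sup_comm _ _)), Finset.pair_comm]
  by_cases h7 : y = z
  · subst h7
    rw [key hy hx hu ((sup_comm _ _).trans he), Finset.pair_comm]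
  by_cases h8 : y = u
  · subst h8
    rw [key hy hx hz ((sup_comm _ _).trans (he.trans (sup_comm _ _)))]
  exact absurd he (h4 x hx y hy z hz u hu (by
    rw [card_insert_of_notMem (by simp [h1, h5, h6]), card_insert_of_notMem (by simp [h7, h8]),
      card_pair h2]))

theorem exists_eq_pair_of_card_le_two {β : Type*} [DecidableEq β] {D : Finset β}
    (h0 : D.Nonempty) (h2 : #D ≤ 2) : ∃ x ∈ D, ∃ y ∈ D, D = {x, y} := by
  have : 0 < #D := h0.card_pos
  obtain h | h : #D = 1 ∨ #D = 2 := by omega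
  · obtain ⟨x, rfl⟩ := card_eq_one.1 h
    exact ⟨x, by simp, x, by simp, by simp⟩
  · obtain ⟨x, y, -, rfl⟩ := card_eq_two.1 h
    exact ⟨x, by simp, y, by simp, rfl⟩

/-- A family of vectors of weight `w` gives a `2`-UFFD code if it has no coincidences between
Boolean sums of two vectors, and a Boolean sum covers few of its members. -/
theorem card_mem_cardinalities {t w m : ℕ} (hw : 1 ≤ w) {S : Finset (Fin t → Bool)}
    (hS : S ⊆ weightVectors t w)
    (h3 : ∀ x ∈ S, ∀ y ∈ S, ∀ z ∈ S, x ≠ y → x ≠ z → y ≠ z → x ⊔ y ≠ x ⊔ z)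
    (h4 : ∀ x ∈ S, ∀ y ∈ S, ∀ z ∈ S, ∀ u ∈ S, ({x, y, z, u} : Finset _).card = 4 →
      x ⊔ y ≠ z ⊔ u)
    (hm : ∀ U : Fin t → Bool, weight U ≤ 2 * w → #{x ∈ S | x ≤ U} ≤ m) (hmS : m ^ 2 ≤ #S) :
    #S ∈ cardinalities t 2 := by
  classical
  set e := S.equivFin
  set C : Matrix (Fin t) (Fin #S) Bool := fun i j => (e.symm j).1 i with hC
  have hinj : Function.Injective fun j => C.col j := fun i j hij =>
    e.symm.injective (Subtype.ext hij)
  have hmem : ∀ j, C.col j ∈ S := fun j => (e.symm j).2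
  have hwt : ∀ j, weight (C.col j) = w := fun j => mem_weightVectors.1 (hS (hmem j))
  have hpair : ∀ a b, outcome C {a, b} = C.col a ⊔ C.col b := fun a b => by
    simp [outcome, sup_insert]
  have hempty : ∀ D : Finset (Fin #S), D.Nonempty → outcome C D ≠ outcome C ∅ := by
    rintro D ⟨a, ha⟩ h
    have h1 : C.col a ≤ outcome C D := Finset.le_sup (f := fun j => C.col j) ha
    have h2 := weight_mono h1
    rw [h, hwt, outcome, sup_empty] at h2
    have : weight (⊥ : Fin t → Bool) = 0 := by simp [weight]
    omega
  refine ⟨C, ?_, ?_⟩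
  · intro D₁ D₂ hD₁ hD₂ hne heq
    rcases D₁.eq_empty_or_nonempty with rfl | hn₁
    · exact hempty D₂ (Finset.nonempty_iff_ne_empty.2 hne.symm) heq.symm
    rcases D₂.eq_empty_or_nonempty with rfl | hn₂
    · exact hempty D₁ hn₁ heq
    obtain ⟨a, -, b, -, rfl⟩ := exists_eq_pair_of_card_le_two hn₁ hD₁
    obtain ⟨c, -, d, -, rfl⟩ := exists_eq_pair_of_card_le_two hn₂ hD₂
    rw [hpair, hpair] at heq
    have := pair_eq_pair_of_sup_eq_sup hS h3 h4 (hmem a) (hmem b) (hmem c) (hmem d) heq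
    apply hne
    apply Finset.image_injective hinj
    simpa [Finset.image_insert] using this
  · intro D hD
    have hU : weight (outcome C D) ≤ 2 * w := by
      rcases D.eq_empty_or_nonempty with rfl | hn
      · simp [outcome, weight]
      obtain ⟨a, -, b, -, rfl⟩ := exists_eq_pair_of_card_le_two hn hD
      rw [hpair]
      have := weight_sup_le (C.col a) (C.col b)
      rw [hwt, hwt] at this
      omega
    have h1 : {j : Fin #S | Covers (outcome C D) (C.col j)}.ncard ≤ m := by
      refine le_trans ?_ (hm _ hU)
      rw [← Set.ncard_coe_finset {x ∈ S | x ≤ outcome C D}]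
      refine Set.ncard_le_ncard_of_injOn (fun j => C.col j) ?_ hinj.injOn
      intro j hj
      exact Finset.mem_coe.2 (Finset.mem_filter.2 ⟨hmem j, sup_eq_left.1 hj⟩)
    rw [Nat.cast_ofNat, ← Real.sqrt_eq_rpow]
    refine Real.le_sqrt_of_sq_le ?_
    exact_mod_cast (Nat.pow_le_pow_left h1 2).trans hmS

/-- The random coding bound for codes of constant weight. -/
theorem exists_mem_cardinalities {t w m : ℕ} (hw : 1 ≤ w) {ρ μ l N : ℝ} (h0 : 0 ≤ ρ) (h1 : ρ ≤ 1)
    (hμ : 0 < μ) (hl : 0 < l) (hN : ρ * t.choose w = N) (hm : (m : ℝ) ^ 2 ≤ N / 2)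
    (hlt : N / 2 + ρ ^ 3 * (t.choose w * ((1 + μ) ^ (2 * w) * (1 + μ ^ 2) ^ (t - w) / μ ^ (2 * w)))
      + ρ ^ 4 * ((1 + (2 * l + l ^ 2) ^ 2) ^ t / l ^ (4 * w))
      + 2 ^ t * (t.choose w * (1 + ρ) ^ 4 ^ w / 2 ^ m) < N) :
    ∃ n ∈ cardinalities t 2, N / 2 ≤ n := by
  classical
  have hN0 : 0 ≤ N := hN ▸ by positivity
  set s := weightVectors t w with hs
  -- The filters on cardinality discard degenerate solutions such as `y = z`, which `supPairs` and
  -- `supQuadruples` include.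
  set E₃ : Finset (Finset (Fin t → Bool)) :=
    (s.biUnion fun x => (supPairs w x).image fun q => {x, q.1, q.2}).filter (#· = 3) with hE₃
  set E₄ : Finset (Finset (Fin t → Bool)) :=
    ((supQuadruples t w).image fun q => {q.1, q.2.1, q.2.2.1, q.2.2.2}).filter (#· = 4) with hE₄
  set V : Finset (Finset (Fin t → Bool)) :=
    (univ.filter fun U : Fin t → Bool => weight U ≤ 2 * w).image fun U => {x ∈ s | x ≤ U} with hV
  have c3 : (#E₃ : ℝ) ≤ t.choose w * ((1 + μ) ^ (2 * w) * (1 + μ ^ 2) ^ (t - w) / μ ^ (2 * w)) := by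
    have : (#E₃ : ℝ) ≤ ∑ x ∈ s, (#(supPairs w x) : ℝ) := by
      exact_mod_cast ((card_filter_le _ _).trans card_biUnion_le).trans
        (sum_le_sum fun x _ => card_image_le)
    refine this.trans ?_
    rw [← card_weightVectors, ← nsmul_eq_mul]
    refine sum_le_card_nsmul _ _ _ fun x hx => ?_
    rw [le_div_iff₀ (by positivity)]
    exact card_supPairs_mul_le (mem_weightVectors.1 hx) hμ
  have c4 : (#E₄ : ℝ) ≤ (1 + (2 * l + l ^ 2) ^ 2) ^ t / l ^ (4 * w) := by
    rw [le_div_iff₀ (by positivity)]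
    refine le_trans ?_ (card_supQuadruples_mul_le t w hl)
    gcongr
    exact (card_filter_le _ _).trans card_image_le
  have cV : #V ≤ 2 ^ t := by
    refine card_image_le.trans ((card_filter_le _ _).trans ?_)
    simp
  have hvc : ∀ v ∈ V, #v ≤ 4 ^ w := by
    intro v hv
    obtain ⟨U, hU, rfl⟩ := Finset.mem_image.1 hv
    refine (card_filter_le_le U).trans ?_
    rw [show 4 = 2 ^ 2 from rfl, ← pow_mul]
    exact Nat.pow_le_pow_right two_pos (Finset.mem_filter.1 hU).2
  obtain ⟨S, hSs, hSL, hSE, hSV⟩ := exists_large_subset s (E₃ ∪ E₄) V (L := N / 2) (m := m) h0 h1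
    (by
      intro e he
      rcases Finset.mem_union.1 he with he | he
      · obtain ⟨he, hc⟩ := Finset.mem_filter.1 he
        refine ⟨card_pos.1 (by omega), ?_⟩
        obtain ⟨x, hx, he⟩ := Finset.mem_biUnion.1 he
        obtain ⟨q, hq, rfl⟩ := Finset.mem_image.1 he
        simp only [supPairs, Finset.mem_filter, Finset.mem_product] at hq
        simp only [Finset.insert_subset_iff, Finset.singleton_subset_iff]
        exact ⟨hx, hq.1.1, hq.1.2⟩
      · obtain ⟨he, hc⟩ := Finset.mem_filter.1 he
        refine ⟨card_pos.1 (by omega), ?_⟩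
        obtain ⟨q, hq, rfl⟩ := Finset.mem_image.1 he
        simp only [supQuadruples, Finset.mem_filter, Finset.mem_product] at hq
        obtain ⟨⟨q1, q2, q3, q4⟩, -⟩ := hq
        simp only [Finset.insert_subset_iff, Finset.singleton_subset_iff]
        exact ⟨q1, q2, q3, q4⟩)
    (by
      intro v hv
      obtain ⟨U, -, rfl⟩ := Finset.mem_image.1 hv
      exact Finset.filter_subset _ _)
    (by positivity)
    (by
      have s3 : ∑ e ∈ E₃, ρ ^ #e = ρ ^ 3 * #E₃ := by
        rw [mul_comm, ← nsmul_eq_mul, ← sum_const]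
        exact sum_congr rfl fun e he => by rw [(Finset.mem_filter.1 he).2]
      have s4 : ∑ e ∈ E₄, ρ ^ #e = ρ ^ 4 * #E₄ := by
        rw [mul_comm, ← nsmul_eq_mul, ← sum_const]
        exact sum_congr rfl fun e he => by rw [(Finset.mem_filter.1 he).2]
      have su : ∑ e ∈ E₃ ∪ E₄, ρ ^ #e ≤ ∑ e ∈ E₃, ρ ^ #e + ∑ e ∈ E₄, ρ ^ #e := by
        rw [← sum_union_inter]
        exact le_add_of_nonneg_right (sum_nonneg fun _ _ => by positivity)
      have sV : ∑ v ∈ V, #s * (1 + ρ) ^ #v / 2 ^ m ≤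
          2 ^ t * (t.choose w * (1 + ρ) ^ 4 ^ w / 2 ^ m) := by
        calc _ ≤ #V • (t.choose w * (1 + ρ) ^ 4 ^ w / 2 ^ m : ℝ) := by
              refine sum_le_card_nsmul _ _ _ fun v hv => ?_
              rw [hs, card_weightVectors]
              have := hvc v hv
              gcongr
              linarith
          _ ≤ _ := by
              rw [nsmul_eq_mul]
              gcongr
              exact_mod_cast cV
      have b3 := mul_le_mul_of_nonneg_left c3 (pow_nonneg h0 3)
      have b4 := mul_le_mul_of_nonneg_left c4 (pow_nonneg h0 4)
      rw [hs, card_weightVectors, hN]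
      rw [hs, card_weightVectors] at sV
      linarith)
  refine ⟨#S, card_mem_cardinalities (m := m) hw hSs ?_ ?_ ?_ ?_, hSL.le⟩
  · intro x hx y hy z hz hxy hxz hyz he
    refine hSE {x, y, z} (Finset.mem_union_left _ (Finset.mem_filter.2 ⟨?_, ?_⟩)) ?_
    · refine Finset.mem_biUnion.2 ⟨x, hSs hx, Finset.mem_image.2 ⟨(y, z), ?_, rfl⟩⟩
      exact Finset.mem_filter.2 ⟨Finset.mem_product.2 ⟨hSs hy, hSs hz⟩, he⟩
    · rw [card_insert_of_notMem (by simp [hxy, hxz]), card_pair hyz]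
    · simp [Finset.insert_subset_iff, hx, hy, hz]
  · intro x hx y hy z hz u hu hc he
    refine hSE {x, y, z, u} (Finset.mem_union_right _ (Finset.mem_filter.2 ⟨?_, hc⟩)) ?_
    · refine Finset.mem_image.2 ⟨(x, y, z, u), Finset.mem_filter.2 ⟨?_, he⟩, rfl⟩
      simp only [Finset.mem_product]
      exact ⟨hSs hx, hSs hy, hSs hz, hSs hu⟩
    · simp [Finset.insert_subset_iff, hx, hy, hz, hu]
  · intro U hU
    refine le_trans (Finset.card_le_card ?_) (hSV {x ∈ s | x ≤ U}
      (Finset.mem_image.2 ⟨U, Finset.mem_filter.2 ⟨Finset.mem_univ _, hU⟩, rfl⟩))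
    intro x hx
    obtain ⟨hx, hxU⟩ := Finset.mem_filter.1 hx
    exact Finset.mem_inter.2 ⟨hx, Finset.mem_filter.2 ⟨hSs hx, hxU⟩⟩
  · have : (m : ℝ) ^ 2 ≤ #S := hm.trans hSL.le
    exact_mod_cast this

end UFFD

/-! ### Asymptotics of the random coding bound -/

namespace UFFD

open Real Topology

/-- The Poisson term `w ^ k / k!` is largest at `k = w`. -/
theorem factorial_mul_pow_le (w k : ℕ) : w.factorial * w ^ k ≤ k.factorial * w ^ w := by
  rcases le_total w k with h | h
  · calc w.factorial * w ^ k = w.factorial * w ^ (k - w) * w ^ w := by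
          rw [mul_assoc, ← pow_add, Nat.sub_add_cancel h]
      _ ≤ _ := Nat.mul_le_mul_right _ (Nat.factorial_mul_pow_sub_le_factorial h)
  · have h1 := Nat.factorial_mul_descFactorial (Nat.sub_le w k)
    rw [Nat.sub_sub_self h] at h1
    calc w.factorial * w ^ k = k.factorial * (w.descFactorial (w - k) * w ^ k) := by
          rw [← h1, mul_assoc]
      _ ≤ k.factorial * (w ^ (w - k) * w ^ k) := by
          gcongr
          exact Nat.descFactorial_le_pow _ _
      _ = _ := by rw [← pow_add, Nat.sub_add_cancel h]

/-- The binomial distribution with success probability `w / (w + v)` has mode `w`: multiply the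
Poisson bounds for `w` and `v`. -/
theorem choose_mul_pow_le {w v k : ℕ} (hk : k ≤ w + v) :
    w ^ k * v ^ (w + v - k) * (w + v).choose k ≤ w ^ w * v ^ v * (w + v).choose w := by
  have h1 := Nat.mul_le_mul (factorial_mul_pow_le w k) (factorial_mul_pow_le v (w + v - k))
  have e1 := Nat.choose_mul_factorial_mul_factorial hk
  have e2 := Nat.choose_mul_factorial_mul_factorial (Nat.le_add_right w v)
  rw [Nat.add_sub_cancel_left] at e2
  have hpos : 0 < k.factorial * (w + v - k).factorial * (w.factorial * v.factorial) := by positivity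
  refine Nat.le_of_mul_le_mul_right ?_ hpos
  calc _ = (w.factorial * w ^ k * (v.factorial * v ^ (w + v - k))) *
        ((w + v).choose k * k.factorial * (w + v - k).factorial) := by ring
    _ ≤ (k.factorial * w ^ w * ((w + v - k).factorial * v ^ v)) *
        ((w + v).choose k * k.factorial * (w + v - k).factorial) := Nat.mul_le_mul_right _ h1
    _ = (k.factorial * w ^ w * ((w + v - k).factorial * v ^ v)) *
        ((w + v).choose w * w.factorial * v.factorial) := by rw [e1, e2]
    _ = _ := by ring

theorem add_pow_le_mul_choose (w v : ℕ) :
    (w + v) ^ (w + v) ≤ (w + v + 1) * (w ^ w * v ^ v * (w + v).choose w) := by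
  rw [add_pow]
  refine (Finset.sum_le_card_nsmul _ _ _ fun k hk => choose_mul_pow_le (w := w) (v := v) ?_).trans ?_
  · exact Nat.lt_succ_iff.1 (Finset.mem_range.1 hk)
  · simp

/-- The entropy lower bound for binomial coefficients. -/
theorem exp_mul_binEntropy_le {t w : ℕ} (hw : 0 < w) (hwt : w < t) :
    exp (t * binEntropy (w / t)) ≤ (t + 1) * t.choose w := by
  obtain ⟨v, rfl⟩ := Nat.exists_eq_add_of_lt hwt
  set v' := v + 1 with hv
  rw [add_assoc, ← hv] at *
  have hw' : (0 : ℝ) < w := by exact_mod_cast hw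
  have hv' : (0 : ℝ) < v' := by positivity
  have h1 : (((w + v' : ℕ) : ℝ)) ^ (w + v') ≤
      ((w + v' : ℕ) + 1) * (w ^ w * v' ^ v' * (w + v').choose w) := by
    exact_mod_cast add_pow_le_mul_choose w v'
  rw [mul_binEntropy_div_eq hw' (by push_cast; linarith),
    show ((w + v' : ℕ) : ℝ) - w = v' by push_cast; ring]
  have e : ∀ x : ℕ, 0 < (x : ℝ) → exp (x * log x) = (x : ℝ) ^ x := fun x hx => by
    rw [mul_comm, exp_mul, exp_log hx, rpow_natCast]
  rw [sub_sub, exp_sub, exp_add, e _ hw', e _ hv', e _ (by push_cast; positivity),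
    div_le_iff₀ (by positivity)]
  linarith

theorem eventually_pow_le_exp {ε : ℝ} (hε : 0 < ε) :
    ∀ᶠ t : ℕ in atTop, 16 * ((t : ℝ) + 1) ^ 4 ≤ exp (ε * t) := by
  have h1 : Tendsto (fun t : ℕ => ε * ((t : ℝ) + 1)) atTop atTop :=
    (tendsto_atTop_add_const_right _ _ tendsto_natCast_atTop_atTop).const_mul_atTop hε
  have h2 := (tendsto_pow_mul_exp_neg_atTop_nhds_zero 4).comp h1
  have h3 : 0 < ε ^ 4 / (16 * exp ε) := by positivity
  filter_upwards [h2.eventually_lt_const h3] with t ht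
  simp only [Function.comp] at ht
  rw [lt_div_iff₀ (by positivity), exp_neg, mul_pow, mul_add, exp_add, mul_one] at ht
  have he := exp_pos ε
  have he' := exp_pos (ε * t)
  field_simp at ht
  linarith

/-- The exponent `m log 2`, about `0.35 Q`, outweighs `x ≤ Q / 16` together with `2 t log 2`, as `t
+ 1 ≤ Q / 16`. -/
theorem two_pow_mul_exp_div_le {Q : ℝ} {t m : ℕ} {x C : ℝ} (hm : m = ⌊Q / 2⌋₊) (hQ : 16 * ((t : ℝ) + 1) ≤ Q)
    (hx : x ≤ Q / 16) (hC : C ≤ 2 ^ t) :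
    2 ^ t * (C * exp x / 2 ^ m) ≤ 1 / 16 := by
  have l1 := log_two_gt_d9
  have l2 := log_two_lt_d9
  have h1 : Q / 2 - 1 ≤ m := by rw [hm]; linarith [Nat.lt_floor_add_one (Q / 2)]
  have e : ∀ n : ℕ, (2 : ℝ) ^ n = exp (n * log 2) := fun n => by
    rw [mul_comm, exp_mul, exp_log two_pos, rpow_natCast]
  have e16 : (1 / 16 : ℝ) = exp (-((4 : ℕ) * log 2)) := by rw [exp_neg, ← e]; norm_num
  calc (2 : ℝ) ^ t * (C * exp x / 2 ^ m) ≤ 2 ^ t * (2 ^ t * exp x / 2 ^ m) := by gcongr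
    _ = exp (t * log 2 + t * log 2 + x - m * log 2) := by
        rw [exp_sub, exp_add, exp_add, e, e]; ring
    _ ≤ 1 / 16 := by
        rw [e16, exp_le_exp]
        have h2 : (Q / 2 - 1) * log 2 ≤ m * log 2 := by gcongr
        have ht : (0 : ℝ) ≤ t := t.cast_nonneg
        push_cast
        nlinarith

theorem exp_dual₁ {t w : ℕ} (hw : w < t) {μ : ℝ} (hμ : 0 < μ) :
    (1 + μ) ^ (2 * w) * (1 + μ ^ 2) ^ (t - w) / μ ^ (2 * w) =
      exp (t * (2 * binEntropy (w / t) - dual₁ (w / t) μ)) := by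
  have ht : (0 : ℝ) < t := by exact_mod_cast (Nat.zero_le w).trans_lt hw
  have e : ∀ x : ℝ, 0 < x → ∀ n : ℕ, x ^ n = exp (n * log x) := fun x hx n => by
    rw [mul_comm, exp_mul, exp_log hx, rpow_natCast]
  rw [e _ (by positivity) (2 * w), e _ (by positivity) (t - w), e μ hμ (2 * w), ← exp_add, ← exp_sub,
    dual₁, Nat.cast_sub hw.le]
  congr 1
  push_cast
  field_simp
  ring

theorem exp_dual₀ {t w : ℕ} (hw : w < t) {l : ℝ} (hl : 0 < l) :
    (1 + (2 * l + l ^ 2) ^ 2) ^ t / l ^ (4 * w) =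
      exp (t * (4 * binEntropy (w / t) - dual₀ (w / t) l)) := by
  have ht : (0 : ℝ) < t := by exact_mod_cast (Nat.zero_le w).trans_lt hw
  have e : ∀ x : ℝ, 0 < x → ∀ n : ℕ, x ^ n = exp (n * log x) := fun x hx n => by
    rw [mul_comm, exp_mul, exp_log hx, rpow_natCast]
  rw [e _ (by positivity) t, e l hl (4 * w), ← exp_sub, dual₀]
  congr 1
  push_cast
  field_simp
  ring

/-- With `N = exp (r t)`, the conditions `h0` to `h3` serve in turn `ρ ≤ 1`, the triples, the
quadruples and the covering. The slack `ε` absorbs the powers of `t + 1` lost in the bound on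
`t.choose w`. The expected losses are at most `N / 16`, `N / 16` and `1 / 16`, so more than `N / 2`
vectors survive. -/
theorem exp_half_le_maxCard {t w : ℕ} {r μ l ε : ℝ} (hw : 0 < w) (hwt : w < t) (hr : 0 < r)
    (hμ : 0 < μ) (hl : 0 < l) (h0 : r + ε ≤ binEntropy (w / t))
    (h1 : 2 * r + ε ≤ dual₁ (w / t) μ) (h2 : 3 * r + ε ≤ dual₀ (w / t) l)
    (h3 : r / 2 + ε ≤ binEntropy (w / t) - 2 * (w / t) * log 2)
    (hε : 16 * ((t : ℝ) + 1) ^ 4 ≤ exp (ε * t)) (hQ : 16 * ((t : ℝ) + 1) ^ 4 ≤ exp (r / 2 * t)) :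
    exp (r * t) / 2 ≤ maxCard t 2 := by
  have ht : (0 : ℝ) < t := by exact_mod_cast hw.trans hwt
  set q : ℝ := w / t with hq
  set H := binEntropy q with hH
  set T : ℝ := t + 1 with hT
  have hT1 : 1 ≤ T := by linarith
  set Q := exp (r / 2 * t) with hQdef
  -- `Q = √N` is the scale of the permitted number of covered columns; `m = ⌊Q / 2⌋` satisfies `m ^
  -- 2 ≤ N / 2`.
  have hNQ : exp (r * t) = Q ^ 2 := by rw [hQdef, ← exp_nat_mul]; congr 1; push_cast; ring
  have hC := exp_mul_binEntropy_le hw hwt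
  rw [← hq, ← hH, ← hT] at hC
  have hC0 : (0 : ℝ) < t.choose w := by exact_mod_cast Nat.choose_pos hwt.le
  set ρ : ℝ := exp (r * t) / t.choose w with hρ
  have hρ0 : 0 ≤ ρ := by positivity
  have hρle : ρ ≤ T * exp (t * (r - H)) := by
    rw [hρ, div_le_iff₀ hC0, mul_sub, exp_sub, mul_comm r]
    have := exp_pos (t * r)
    have := exp_pos (t * H)
    rw [mul_div_assoc', div_mul_eq_mul_div, le_div_iff₀ this]
    nlinarith
  have key : ∀ k ≤ 4, ∀ x : ℝ, x ≤ -ε → T ^ k * exp (t * x) ≤ 1 / 16 := by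
    intro k hk x hx
    have a1 : T ^ k ≤ T ^ 4 := pow_le_pow_right₀ hT1 hk
    have a2 : exp (t * x) ≤ (exp (ε * t))⁻¹ := by
      rw [← exp_neg, exp_le_exp]; nlinarith
    calc T ^ k * exp (t * x) ≤ T ^ 4 * (exp (ε * t))⁻¹ := by gcongr
      _ ≤ 1 / 16 := by
          rw [← div_eq_mul_inv, div_le_iff₀ (exp_pos _)]; linarith
  have hρ1 : ρ ≤ 1 := by
    have := key 1 (by norm_num) (r - H) (by linarith)
    rw [pow_one] at this
    linarith
  have hpow : ∀ k : ℕ, ρ ^ k ≤ T ^ k * exp (t * (k * (r - H))) := fun k => by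
    refine (pow_le_pow_left₀ hρ0 hρle k).trans_eq ?_
    rw [mul_pow, ← exp_nat_mul]
    congr 2
    ring
  have hρC : ρ * t.choose w = exp (r * t) := div_mul_cancel₀ _ hC0.ne'
  have b3 : ρ ^ 3 * (t.choose w *
      ((1 + μ) ^ (2 * w) * (1 + μ ^ 2) ^ (t - w) / μ ^ (2 * w))) ≤ exp (r * t) / 16 := by
    rw [exp_dual₁ hwt hμ, ← hq, ← hH]
    calc _ = exp (r * t) * (ρ ^ 2 * exp (t * (2 * H - dual₁ q μ))) := by rw [← hρC]; ring
      _ ≤ exp (r * t) * (T ^ 2 * exp (t * ((2 : ℕ) * (r - H))) * exp (t * (2 * H - dual₁ q μ))) := by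
          gcongr; exact hpow 2
      _ = exp (r * t) * (T ^ 2 * exp (t * (2 * r - dual₁ q μ))) := by
          rw [mul_assoc (T ^ 2), ← exp_add]; congr 3; push_cast; ring
      _ ≤ exp (r * t) * (1 / 16) := by
          gcongr; exact key 2 (by norm_num) _ (by linarith)
      _ = _ := by ring
  have b4 : ρ ^ 4 * ((1 + (2 * l + l ^ 2) ^ 2) ^ t / l ^ (4 * w)) ≤ exp (r * t) / 16 := by
    rw [exp_dual₀ hwt hl, ← hq, ← hH]
    calc _ ≤ T ^ 4 * exp (t * ((4 : ℕ) * (r - H))) * exp (t * (4 * H - dual₀ q l)) := by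
          gcongr; exact hpow 4
      _ = exp (r * t) * (T ^ 4 * exp (t * (3 * r - dual₀ q l))) := by
          rw [mul_assoc (T ^ 4), ← exp_add, mul_left_comm (exp (r * t)), ← exp_add]; congr 2; push_cast; ring
      _ ≤ exp (r * t) * (1 / 16) := by
          gcongr; exact key 4 le_rfl _ (by linarith)
      _ = _ := by ring
  have hx : ρ * 4 ^ w ≤ Q / 16 := by
    have e4 : (4 : ℝ) ^ w = exp (t * (2 * q * log 2)) := by
      rw [show (4 : ℝ) = 2 ^ 2 by norm_num, ← pow_mul, ← rpow_natCast, rpow_def_of_pos two_pos]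
      congr 1
      rw [hq]
      push_cast
      field_simp
    calc ρ * 4 ^ w ≤ T * exp (t * (r - H)) * exp (t * (2 * q * log 2)) := by rw [e4]; gcongr
      _ = Q * (T ^ 1 * exp (t * (r / 2 - H + 2 * q * log 2))) := by
          rw [pow_one, hQdef, mul_assoc T, ← exp_add, mul_left_comm (exp (r / 2 * t)), ← exp_add]; congr 2; ring
      _ ≤ Q * (1 / 16) := by
          gcongr; exact key 1 (by norm_num) _ (by linarith)
      _ = _ := by ring
  have hQ16 : 16 * ((t : ℝ) + 1) ≤ Q := by
    refine le_trans ?_ hQ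
    gcongr
    exact le_self_pow₀ hT1 (by norm_num)
  have hch : (t.choose w : ℝ) ≤ 2 ^ t := by exact_mod_cast Nat.choose_le_two_pow t w
  have bV : 2 ^ t * (t.choose w * (1 + ρ) ^ 4 ^ w / 2 ^ ⌊Q / 2⌋₊) ≤ (1 / 16 : ℝ) := by
    refine le_trans ?_ (two_pow_mul_exp_div_le rfl hQ16 hx hch)
    gcongr
    calc (1 + ρ) ^ 4 ^ w ≤ exp ρ ^ 4 ^ w := by
          gcongr
          linarith [add_one_le_exp ρ]
      _ = exp (ρ * 4 ^ w) := by rw [← exp_nat_mul]; push_cast; ring_nf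
  have hN1 : 1 ≤ exp (r * t) := one_le_exp (by positivity)
  obtain ⟨n, hn, hNn⟩ := exists_mem_cardinalities (m := ⌊Q / 2⌋₊) hw hρ0 hρ1 hμ hl hρC
    (by
      have : (⌊Q / 2⌋₊ : ℝ) ≤ Q / 2 := Nat.floor_le (by positivity)
      rw [hNQ]
      nlinarith [Nat.cast_nonneg (α := ℝ) ⌊Q / 2⌋₊])
    (by linarith)
  exact hNn.trans (by exact_mod_cast (isGreatest_maxCard one_le_two).2 hn)

/-- The asymptotic form of the random coding bound. -/
theorem eventually_exp_half_le_maxCard {p r μ l : ℝ} (hp : p ∈ Ioo (0 : ℝ) 1) (hr : 0 < r)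
    (hμ : 0 < μ) (hl : 0 < l) (h0 : r < binEntropy p) (h1 : 2 * r < dual₁ p μ)
    (h2 : 3 * r < dual₀ p l) (h3 : r / 2 < binEntropy p - 2 * p * log 2) :
    ∀ᶠ t : ℕ in atTop, exp (r * t) / 2 ≤ maxCard t 2 := by
  obtain ⟨ε, hε, hεlt⟩ : ∃ ε > 0, ε < min (min (binEntropy p - r) (dual₁ p μ - 2 * r))
      (min (dual₀ p l - 3 * r) (binEntropy p - 2 * p * log 2 - r / 2)) :=
    exists_between (by simp only [lt_min_iff]; refine ⟨⟨?_, ?_⟩, ?_, ?_⟩ <;> linarith)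
  simp only [lt_min_iff] at hεlt
  obtain ⟨⟨e0, e1⟩, e2, e3⟩ := hεlt
  have hw : Tendsto (fun t : ℕ => (⌊p * t⌋₊ : ℝ) / t) atTop (𝓝 p) :=
    (tendsto_nat_floor_mul_div_atTop hp.1.le).comp tendsto_natCast_atTop_atTop
  have c1 : Continuous fun q => dual₁ q μ := by unfold dual₁; fun_prop
  have c0 : Continuous fun q => dual₀ q l := by unfold dual₀; fun_prop
  have c3 : Continuous fun q : ℝ => binEntropy q - 2 * q * log 2 := by fun_prop
  filter_upwards [hw.eventually_const_lt hp.1, hw.eventually_lt_const hp.2,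
    eventually_gt_atTop 0, eventually_pow_le_exp hε, eventually_pow_le_exp (half_pos hr),
    ((binEntropy_continuous.tendsto p).comp hw).eventually_const_lt (show r + ε < _ by linarith),
    ((c1.tendsto p).comp hw).eventually_const_lt (show 2 * r + ε < _ by linarith),
    ((c0.tendsto p).comp hw).eventually_const_lt (show 3 * r + ε < _ by linarith),
    ((c3.tendsto p).comp hw).eventually_const_lt (show r / 2 + ε < _ by linarith)]
    with t w0 w1 ht x0 x1 y0 y1 y2 y3
  have ht' : (0 : ℝ) < t := by exact_mod_cast ht
  rw [div_lt_one ht'] at w1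
  refine exp_half_le_maxCard (w := ⌊p * t⌋₊) (μ := μ) (l := l) (ε := ε) ?_ (by exact_mod_cast w1)
    hr hμ hl y0.le y1.le y2.le y3.le x0 x1
  rw [Nat.pos_iff_ne_zero]
  intro h
  rw [h] at w0
  simp at w0

theorem le_rate_of_eventually {r : ℝ}
    (h : ∀ᶠ t : ℕ in atTop, exp (r * log 2 * t) / 2 ≤ maxCard t 2) : r ≤ rate 2 := by
  have l2 : 0 < log 2 := log_pos one_lt_two
  refine le_of_forall_lt fun s hs => ?_
  obtain ⟨s', hs', hsr⟩ := exists_between hs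
  refine hs'.trans_le ?_
  refine le_limsup_of_frequently_le (Eventually.frequently ?_)
    (isBoundedUnder_of ⟨1, fun t => (rate_seq_mem_Icc one_le_two t).2⟩)
  have hd : 0 < r - s' := by linarith
  -- The factor `1 / 2` costs `1 / t` in the rate, at most `r - s'` for such `t`.
  filter_upwards [h, eventually_gt_atTop 0,
    tendsto_natCast_atTop_atTop.eventually_ge_atTop (1 / (r - s'))] with t ht h0 h1
  have h0' : (0 : ℝ) < t := by exact_mod_cast h0
  rw [div_le_iff₀ hd] at h1
  rw [le_div_iff₀ h0', logb, le_div_iff₀ l2]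
  have h2 := log_le_log (by positivity) ht
  rw [log_div (exp_pos _).ne' two_ne_zero, log_exp] at h2
  nlinarith

theorem rate_nonneg {d : ℕ} (hd : 1 ≤ d) : 0 ≤ rate d :=
  le_limsup_of_frequently_le (Eventually.of_forall fun t => (rate_seq_mem_Icc hd t).1).frequently
    (isBoundedUnder_of ⟨1, fun t => (rate_seq_mem_Icc hd t).2⟩)

theorem min_le_rate {p : ℝ} (hp : p ∈ Icc (1 / 8 : ℝ) (2 / 5)) :
    min (R₀ p) (R₁ p) ≤ rate 2 := by
  have l2 : 0 < log 2 := log_pos one_lt_two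
  have hp' : p ∈ Ioo (0 : ℝ) 1 := ⟨by linarith [hp.1], by linarith [hp.2]⟩
  refine le_of_forall_lt_imp_le_of_dense fun r hr => ?_
  rcases le_or_gt r 0 with hr0 | hr0
  · exact hr0.trans (rate_nonneg one_le_two)
  obtain ⟨r0, r1⟩ := lt_min_iff.1 hr
  obtain ⟨μ, hμ, eμ⟩ := (isLeast_R₁ hp').2
  obtain ⟨l, hl, el⟩ := (isLeast_R₀ hp').2
  have hH : binEntropy p = h p * log 2 := by
    rw [h_eq_binEntropy_div, div_mul_cancel₀ _ l2.ne']
  have b1 := R₁_le hp'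
  have b2 := R₁_lt_two_mul hp
  -- Positivity of `r` and `r < (1 - p) * h p / 2` force `h p > 0`, hence `r < h p`.
  have hh : r < h p := by nlinarith [hp'.1]
  have s1 := mul_lt_mul_of_pos_right r1 l2
  have s0 := mul_lt_mul_of_pos_right r0 l2
  have sh := mul_lt_mul_of_pos_right hh l2
  have s2 := mul_lt_mul_of_pos_right (r1.trans b2) l2
  refine le_rate_of_eventually (eventually_exp_half_le_maxCard hp' (mul_pos hr0 l2) hμ hl ?_ ?_ ?_ ?_)
  · rw [hH]; exact sh
  · rw [← eμ]; linarith
  · rw [← el]; linarith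
  · rw [hH]; linarith

end UFFD

theorem mainTheorem1 :
    (0.3017 : ℝ) ≤ UFFD.rate 2 ∧
    -- the minima that define `R₀` and `R₁` are attained
    (∀ p ∈ Set.Ioo (0 : ℝ) 1,
      IsLeast (UFFD.F₀ p '' UFFD.A p) (UFFD.R₀ p) ∧
      IsLeast (UFFD.F₁ p '' UFFD.A p) (UFFD.R₁ p)) ∧
    -- the maximum over `p` is attained and bounds the rate from below
    ∃ M : ℝ, IsGreatest ((fun p => min (UFFD.R₀ p) (UFFD.R₁ p)) '' Set.Ioo (0 : ℝ) 1) M ∧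
      M ≤ UFFD.rate 2 := by
  obtain ⟨p, hp, hlow, hmax⟩ := UFFD.exists_maximizer
  have hrate := UFFD.min_le_rate hp
  refine ⟨hlow.trans hrate, fun q hq => ⟨(UFFD.isLeast_R₀ hq).1, (UFFD.isLeast_R₁ hq).1⟩,
    _, ⟨⟨p, ⟨by linarith [hp.1], by linarith [hp.2]⟩, rfl⟩, ?_⟩, hrate⟩
  rintro _ ⟨q, hq, rfl⟩
  exact hmax q hq
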